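/- **Setting.** For a partition $\lambda=(\lambda_1\ge\lambda_2\ge\cdots)$ let $m_\lambda$ and $p_\lambda$ be the monomial and power sum symmetric functions, $\ell(\lambda)$ the number of parts, $m_i(\lambda)$ the number of parts equal to $i$ and $z_\lambda=\prod_i i^{m_i(\lambda)}m_i(\lambda)!$. For an indeterminate $b$, the Jack symmetric functions $P_\lambda^{(b)}\in\Lambda_{\mathbb Q(b)}$ are the symmetric functions determined by: (i) $P_\lambda^{(b)}-m_\lambda$ is a $\mathbb Q(b)$-linear combination of the $m_\mu$ with $\mu<\lambda$ in the dominance order; (ii) $\langle P_\lambda^{(b)},P_\mu^{(b)}\rangle_b=0$ for $\lambda\ne\mu$, where $\langle p_\lambda,p_\mu\rangle_b=\delta_{\lambda,\mu}z_\lambda b^{\ell(\lambda)}$. Let $\alpha\in\mathbb C$ and let $\mathcal F_\alpha$ be the Fock space of the Heisenberg algebra $[a_m,a_n]=m\delta_{m+n,0}$, generated by a vector $|\alpha\rangle$ with $a_n|\alpha\rangle=0$ for $n\ge 1$ and $a_0|\alpha\rangle=\alpha|\alpha\rangle$, with basis $a_{-\lambda}|\alpha\rangle=a_{-\lambda_\ell}\cdots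 a_{-\lambda_1}|\alpha\rangle$. Let $\beta$ be a nonzero complex number, $\beta^{1/2}$ either square root of $\beta$, and put $\beta^{-1/2}=1/\beta^{1/2}$, $\sqrt{2\beta}=\sqrt2\,\beta^{1/2}$, $\sqrt{\beta/2}=\beta^{1/2}/\sqrt2$ and $\rho=(\beta^{1/2}-\beta^{-1/2})/\sqrt2$. Let $\iota_\beta:\mathcal F_\alpha\to\Lambda_{\mathbb C}$ be the linear isomorphism $a_{-\lambda}|\alpha\rangle\mapsto(\sqrt{\beta/2})^{\ell(\lambda)}p_\lambda$, and define the operators on $\mathcal F_\alpha$ $$L_n=\tfrac12\sum_{m\in\mathbb Z}{:}a_ma_{n-m}{:}-(n+1)\rho\,a_n,\qquad \widehat E_\beta=\sqrt{2\beta}\sum_{n>0}a_{-n}L_n+\sum_{n>0}a_{-n}a_n\bigl(\beta-1-\sqrt{2\beta}\,a_0\bigr),$$ where ${:}\ {:}$ is the normal ordering (the sums are finite on each vector). **Proposition.** Let $\lambda$ be any partition, and let $\beta\neq0$ be generic in the sense that none of the coefficients in $\mathbb Q(b)$ of the expansion of $P_\lambda^{(b)}$ in monomial symmetric functions has a pole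 at $b=\beta^{-1}$ (for each $\lambda$ this excludes only finitely many $\beta$). Let $P_\lambda^{(\beta^{-1})}\in\Lambda_{\mathbb C}$ be the specialization at $b=\beta^{-1}$ and let $f_\lambda\in\mathcal F_\alpha$ be the vector with $\iota_\beta(f_\lambda)=P_\lambda^{(\beta^{-1})}$. Then $$\widehat E_\beta f_\lambda=\varepsilon_\lambda(\beta)f_\lambda,\qquad \varepsilon_\lambda(\beta)=\sum_i\bigl(\lambda_i^2+\beta(1-2i)\lambda_i\bigr).$$ -/

import Mathlib

namespace SymFn

open MvPowerSeries

/-- The multiset of nonzero exponents of a monomial `x^e`. -/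
def expType (e : ℕ →₀ ℕ) : Multiset ℕ := e.support.val.map e

theorem card_expType (e : ℕ →₀ ℕ) : (expType e).card = e.support.card := by
  simp [expType]

theorem expType_pos {e : ℕ →₀ ℕ} {a : ℕ} (h : a ∈ expType e) : 0 < a := by
  simp only [expType, Multiset.mem_map] at h
  obtain ⟨i, hi, rfl⟩ := h
  exact Nat.pos_of_ne_zero (Finsupp.mem_support_iff.1 hi)

theorem sum_expType (e : ℕ →₀ ℕ) : (expType e).sum = e.degree := rfl

theorem expType_embDomain (σ : ℕ ↪ ℕ) (e : ℕ →₀ ℕ) : expType (e.embDomain σ) = expType e := by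
  simp [expType, Finsupp.support_embDomain]

theorem expType_add_single {e : ℕ →₀ ℕ} {i a : ℕ} (hi : e i = 0) (ha : a ≠ 0) :
    expType (Finsupp.single i a + e) = a ::ₘ expType e := by
  have hd : Disjoint (Finsupp.single i a).support e.support := by
    rw [Finsupp.support_single _ ha]; simpa using hi
  have hs : (Finsupp.single i a + e).support = Finset.cons i e.support (by simpa using hi) := by
    rw [Finsupp.support_add_eq hd, Finsupp.support_single _ ha]; ext; simp
  rw [expType, hs, Finset.cons_val, Multiset.map_cons]
  congr 1
  · simp [hi]
  · refine Multiset.map_congr rfl fun j hj => ?_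
    have : i ≠ j := by
      rintro rfl; exact (Finsupp.mem_support_iff.1 hj) hi
    simp [this]

theorem exists_expType (s : Multiset ℕ) (hs : ∀ a ∈ s, 0 < a) : ∃ e, expType e = s := by
  induction s using Multiset.induction_on with
  | empty => exact ⟨0, by simp [expType]⟩
  | cons a s ih =>
    obtain ⟨e, rfl⟩ := ih fun b hb => hs b (by simp [hb])
    obtain ⟨i, hi⟩ := Infinite.exists_notMem_finset e.support
    exact ⟨Finsupp.single i a + e,
      expType_add_single (by simpa using hi) (hs a (by simp)).ne'⟩

/-- The ring `Λ_K` of symmetric functions in the variables `x_0, x_1, x_2, …`: formal power series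
of bounded degree that are invariant under all permutations of the variables. -/
noncomputable def Lam (K : Type*) [CommRing K] : Subalgebra K (MvPowerSeries ℕ K) where
  carrier := {f | (∀ σ : Equiv.Perm ℕ, renameEquiv K σ f = f) ∧
    ∃ D : ℕ, ∀ e : ℕ →₀ ℕ, D < e.degree → coeff e f = 0}
  mul_mem' := by
    rintro f g ⟨hf, D, hD⟩ ⟨hg, D', hD'⟩
    refine ⟨fun σ => by rw [map_mul, hf, hg], D + D', fun e he => ?_⟩
    rw [coeff_mul]
    refine Finset.sum_eq_zero fun x hx => ?_
    rw [Finset.HasAntidiagonal.mem_antidiagonal] at hx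
    rw [← hx, map_add] at he
    rcases lt_or_ge D x.1.degree with h | h
    · rw [hD _ h, zero_mul]
    · rw [hD' _ (by omega), mul_zero]
  add_mem' := by
    rintro f g ⟨hf, D, hD⟩ ⟨hg, D', hD'⟩
    refine ⟨fun σ => by rw [map_add, hf, hg], D + D', fun e he => ?_⟩
    rw [map_add, hD _ (by omega), hD' _ (by omega), add_zero]
  algebraMap_mem' := fun r => by
    refine ⟨fun σ => AlgEquiv.commutes _ _, 0, fun e he => ?_⟩
    rw [← c_eq_algebraMap, coeff_C, if_neg]
    rintro rfl
    simp at he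

theorem mem_Lam_iff {K : Type*} [CommRing K] {f : MvPowerSeries ℕ K} : f ∈ Lam K ↔
    (∀ (σ : Equiv.Perm ℕ) (e : ℕ →₀ ℕ), coeff (e.embDomain σ.toEmbedding) f = coeff e f) ∧
    ∃ D : ℕ, ∀ e : ℕ →₀ ℕ, D < e.degree → coeff e f = 0 := by
  have key (σ : Equiv.Perm ℕ) (e : ℕ →₀ ℕ) :
      coeff (e.embDomain σ.toEmbedding) (renameEquiv K σ f) = coeff e f :=
    coeff_embDomain_rename σ.toEmbedding f e
  refine and_congr_left fun _ => ⟨fun h σ e => ?_, fun h σ => ?_⟩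
  · conv_lhs => rw [← h σ]
    exact key σ e
  · ext e
    have he : e = (e.embDomain σ.symm.toEmbedding).embDomain σ.toEmbedding := by
      ext i
      have h1 := Finsupp.embDomain_apply_self σ.toEmbedding (e.embDomain σ.symm.toEmbedding)
        (σ.symm i)
      have h2 := Finsupp.embDomain_apply_self σ.symm.toEmbedding e i
      simp only [Equiv.coe_toEmbedding, Equiv.apply_symm_apply] at h1 h2
      rw [h1, h2]
    conv_lhs => rw [he, key]
    conv_rhs => rw [he, h]

/-- A symmetric function has equal coefficients at monomials with the same exponents. -/
theorem coeff_eq_of_expType_eq {K : Type*} [CommRing K] {f : MvPowerSeries ℕ K} (hf : f ∈ Lam K)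
    {e e' : ℕ →₀ ℕ} (h : expType e = expType e') : coeff e f = coeff e' f := by
  have hfib : ∀ c : ℕ, Nonempty ({i // e i = c} ≃ {i // e' i = c}) := by
    intro c
    rcases Nat.eq_zero_or_pos c with rfl | hc
    · have inf (g : ℕ →₀ ℕ) : Infinite {i // g i = 0} := by
        have : {i | g i = 0} = (g.support : Set ℕ)ᶜ := by ext; simp
        have h2 := (g.support.finite_toSet).infinite_compl
        rw [← this] at h2
        exact h2.to_subtype
      have := inf e
      have := inf e'
      exact nonempty_equiv_of_countable
    · have cnt (g : ℕ →₀ ℕ) : Nat.card {i // g i = c} = (expType g).count c := by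
        rw [expType, Multiset.count_map, ← Finset.filter_val, Finset.card_val,
          ← Nat.card_eq_finsetCard]
        refine Nat.card_congr (Equiv.subtypeEquivRight fun i => ?_)
        simp only [Finset.mem_filter, Finsupp.mem_support_iff]
        omega
      have fin (g : ℕ →₀ ℕ) : Finite {i // g i = c} :=
        Set.Finite.subset g.support.finite_toSet fun i (hi : g i = c) => by
          simp [hi, hc.ne']
      have := fin e
      have := fin e'
      exact (Finite.card_eq).1 (by rw [cnt, cnt, h])
  have F := fun c => (hfib c).some
  let σ : Equiv.Perm ℕ := Equiv.ofFiberEquiv (f := e) (g := e') F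
  have hσ : ∀ i, e' (σ i) = e i := fun i => Equiv.ofFiberEquiv_map F i
  have : e' = e.embDomain σ.toEmbedding := by
    ext i
    obtain ⟨j, rfl⟩ := σ.surjective i
    rw [hσ]
    exact (Finsupp.embDomain_apply_self σ.toEmbedding e j).symm
  rw [this, (mem_Lam_iff.1 hf).1]

/-- The formal power series with given coefficients. -/
def ofCoeff {R : Type*} (c : (ℕ →₀ ℕ) → R) : MvPowerSeries ℕ R := c

theorem coeff_ofCoeff {R : Type*} [Semiring R] (c : (ℕ →₀ ℕ) → R) (e : ℕ →₀ ℕ) :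
    coeff e (ofCoeff c) = c e := rfl

/-- The power sum `p_n = ∑_i x_i ^ n` (for `n ≥ 1`) as a formal power series. -/
noncomputable def psumSeries (R : Type*) [CommSemiring R] (n : ℕ+) : MvPowerSeries ℕ R :=
  open Classical in ofCoeff fun e => if ∃ i, e = Finsupp.single i (n : ℕ) then 1 else 0

theorem coeff_psumSeries (R : Type*) [CommSemiring R] (n : ℕ+) (e : ℕ →₀ ℕ)
    [Decidable (∃ i, e = Finsupp.single i (n : ℕ))] :
    coeff e (psumSeries R n) = if ∃ i, e = Finsupp.single i (n : ℕ) then 1 else 0 := by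
  rw [psumSeries, coeff_ofCoeff]; congr

theorem psumSeries_mem (K : Type*) [CommRing K] (n : ℕ+) : psumSeries K n ∈ Lam K := by
  classical
  refine mem_Lam_iff.2 ⟨fun σ e => ?_, n, fun e he => ?_⟩
  · simp only [coeff_psumSeries]
    congr 1
    refine propext ⟨?_, ?_⟩
    · rintro ⟨i, hi⟩
      refine ⟨σ.symm i, Finsupp.embDomain_injective σ.toEmbedding ?_⟩
      rw [hi, Finsupp.embDomain_single]; simp
    · rintro ⟨i, rfl⟩
      exact ⟨σ i, by rw [Finsupp.embDomain_single]; simp⟩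
  · rw [coeff_psumSeries, if_neg]
    rintro ⟨i, rfl⟩
    simp at he

/-- The power sum symmetric function `p_n`. -/
noncomputable def psum (K : Type*) [CommRing K] (n : ℕ+) : Lam K :=
  ⟨psumSeries K n, psumSeries_mem K n⟩

theorem exists_of_coeff_ne_zero {R : Type*} [CommSemiring R] (s : Multiset ℕ+) (e : ℕ →₀ ℕ)
    (h : coeff e (s.map (psumSeries R)).prod ≠ 0) :
    e.support.card ≤ s.card ∧
      (e.support.card = s.card → expType e = s.map (fun n : ℕ+ => (n : ℕ))) := by
  classical
  induction s using Multiset.induction_on generalizing e with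
  | empty =>
    have : e = 0 := by
      by_contra he
      simp [coeff_one, he] at h
    simp [this, expType]
  | cons a s ih =>
    rw [Multiset.map_cons, Multiset.prod_cons, coeff_mul] at h
    obtain ⟨⟨x, y⟩, hx, hne⟩ := Finset.exists_ne_zero_of_sum_ne_zero h
    rw [Finset.HasAntidiagonal.mem_antidiagonal] at hx
    simp only at hx hne
    rw [coeff_psumSeries] at hne
    obtain ⟨i, rfl⟩ : ∃ i, x = Finsupp.single i (a : ℕ) := by
      by_contra hc
      simp [hc] at hne
    obtain ⟨h1, h2⟩ := ih y (right_ne_zero_of_mul hne)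
    subst hx
    have hle : (Finsupp.single i (a : ℕ) + y).support ⊆ insert i y.support := by
      refine Finsupp.support_add.trans ?_
      rw [Finsupp.support_single _ a.ne_zero]; rfl
    have hc := Finset.card_le_card hle
    by_cases hi : y i = 0
    · have hin : i ∉ y.support := by simpa using hi
      rw [Finset.card_insert_of_notMem hin] at hc
      have e1 : (Finsupp.single i (a : ℕ) + y).support.card = y.support.card + 1 := by
        rw [← card_expType, expType_add_single hi a.ne_zero, Multiset.card_cons, card_expType]
      rw [Multiset.card_cons]
      refine ⟨by omega, fun h => ?_⟩
      rw [expType_add_single hi a.ne_zero, h2 (by omega), Multiset.map_cons]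
    · have hin : i ∈ y.support := by simpa using hi
      rw [Finset.insert_eq_of_mem hin] at hc
      rw [Multiset.card_cons]
      exact ⟨by omega, fun h => by omega⟩

theorem coeff_pos (s : Multiset ℕ+) (e : ℕ →₀ ℕ)
    (h : expType e = s.map (fun n : ℕ+ => (n : ℕ))) :
    0 < coeff e (s.map (psumSeries ℕ)).prod := by
  classical
  induction s using Multiset.induction_on generalizing e with
  | empty =>
    have : e = 0 := by
      simpa [expType] using h
    simp [this]
  | cons a s ih =>
    rw [Multiset.map_cons] at h
    obtain ⟨i, hi, hia⟩ : ∃ i ∈ e.support.val, e i = a := by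
      rw [← Multiset.mem_map]
      change (a : ℕ) ∈ expType e
      simp [h]
    have he : e = Finsupp.single i (a : ℕ) + e.erase i := by
      rw [← hia, Finsupp.single_add_erase]
    have hy : (e.erase i) i = 0 := by simp
    rw [he, expType_add_single hy a.ne_zero] at h
    have := ih (e.erase i) ((Multiset.cons_inj_right _).1 h)
    rw [Multiset.map_cons, Multiset.prod_cons, coeff_mul]
    have hmem : (Finsupp.single i (a : ℕ), e.erase i) ∈
        Finset.HasAntidiagonal.antidiagonal e :=
      Finset.HasAntidiagonal.mem_antidiagonal.2 he.symm
    refine lt_of_lt_of_le ?_ (Finset.single_le_sum (fun _ _ => Nat.zero_le _) hmem)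
    rw [coeff_psumSeries, if_pos ⟨i, rfl⟩, one_mul]
    exact this

theorem coeff_ne_zero {K : Type*} [Field K] [CharZero K] (s : Multiset ℕ+) (e : ℕ →₀ ℕ)
    (h : expType e = s.map (fun n : ℕ+ => (n : ℕ))) :
    coeff e (s.map (psumSeries K)).prod ≠ 0 := by
  classical
  have hm (n : ℕ+) : psumSeries K n = MvPowerSeries.map (Nat.castRingHom K) (psumSeries ℕ n) := by
    ext e
    rw [coeff_map, coeff_psumSeries, coeff_psumSeries]
    split_ifs <;> simp
  have : (s.map (psumSeries K)).prod
      = MvPowerSeries.map (Nat.castRingHom K) (s.map (psumSeries ℕ)).prod := by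
    rw [map_multiset_prod, Multiset.map_map]
    congr 1
    exact Multiset.map_congr rfl fun n _ => hm n
  rw [this, coeff_map]
  simpa using (coeff_pos s e h).ne'

/-- The product `p_λ` of power sums, for the partition `λ` with `d n` parts equal to `n`. -/
theorem aeval_psum_monomial {K : Type*} [Field K] (d : ℕ+ →₀ ℕ) (c : K) :
    ((MvPolynomial.aeval (psum K) (MvPolynomial.monomial d c) : Lam K) : MvPowerSeries ℕ K)
      = c • ((Finsupp.toMultiset d).map (psumSeries K)).prod := by
  rw [MvPolynomial.aeval_monomial, ← Algebra.smul_def, Finsupp.toMultiset_map,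
    Finsupp.prod_toMultiset, Finsupp.prod_mapDomain_index (by simp) (by intros; rw [pow_add])]
  simp [Finsupp.prod, psum]

theorem coeff_aeval_psum {K : Type*} [Field K] (F : MvPolynomial ℕ+ K) (e : ℕ →₀ ℕ) :
    coeff e ((MvPolynomial.aeval (psum K) F : Lam K) : MvPowerSeries ℕ K)
      = ∑ d ∈ F.support, F.coeff d *
          coeff e ((Finsupp.toMultiset d).map (psumSeries K)).prod := by
  conv_lhs => rw [F.as_sum]
  rw [map_sum, AddSubmonoidClass.coe_finsetSum, map_sum]
  exact Finset.sum_congr rfl fun d _ => by rw [aeval_psum_monomial, coeff_smul]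

theorem toMultiset_eq_of_expType {d d' : ℕ+ →₀ ℕ}
    (h : (Finsupp.toMultiset d).map (fun n : ℕ+ => (n : ℕ))
      = (Finsupp.toMultiset d').map (fun n : ℕ+ => (n : ℕ))) : d = d' :=
  (AddEquiv.injective (Multiset.toFinsupp.symm)) (Multiset.map_injective PNat.coe_injective h)

theorem aeval_psum_injective (K : Type*) [Field K] [CharZero K] :
    Function.Injective (MvPolynomial.aeval (psum K) : MvPolynomial ℕ+ K →ₐ[K] Lam K) := by
  rw [injective_iff_map_eq_zero]
  intro F hF
  by_contra hne
  obtain ⟨d, hd, hmax⟩ := Finset.exists_max_image F.support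
    (fun d => (Finsupp.toMultiset d).card) (MvPolynomial.support_nonempty.2 hne)
  obtain ⟨e, he⟩ := exists_expType ((Finsupp.toMultiset d).map (fun n : ℕ+ => (n : ℕ)))
    (by simp)
  have hc : e.support.card = (Finsupp.toMultiset d).card := by
    rw [← card_expType, he, Multiset.card_map]
  have h0 := coeff_aeval_psum F e
  rw [hF, Finset.sum_eq_single d] at h0
  · exact mul_ne_zero (MvPolynomial.mem_support_iff.1 hd) (coeff_ne_zero _ _ he) (by simpa using h0.symm)
  · intro d' hd' hdd
    by_contra hcc
    obtain ⟨h1, h2⟩ := exists_of_coeff_ne_zero _ _ (right_ne_zero_of_mul hcc)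
    have := hmax d' hd'
    have h3 := h2 (by omega)
    rw [he] at h3
    exact hdd (toMultiset_eq_of_expType h3.symm)
  · exact fun h => absurd hd h

theorem aeval_psum_surjective (K : Type*) [Field K] [CharZero K] :
    Function.Surjective (MvPolynomial.aeval (psum K) : MvPolynomial ℕ+ K →ₐ[K] Lam K) := by
  classical
  suffices H : ∀ (k : ℕ) (f : Lam K),
      (∀ e, coeff e (f : MvPowerSeries ℕ K) ≠ 0 → e.support.card < k) →
      f ∈ (MvPolynomial.aeval (psum K) : MvPolynomial ℕ+ K →ₐ[K] Lam K).range by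
    intro f
    obtain ⟨D, hD⟩ := (mem_Lam_iff.1 f.2).2
    refine H (D + 1) f fun e he => ?_
    have h1 : e.degree ≤ D := by
      by_contra h
      exact he (hD e (by omega))
    have h2 : e.support.card ≤ e.degree := by
      rw [Finsupp.degree_apply, Finset.card_eq_sum_ones]
      exact Finset.sum_le_sum fun i hi => Nat.pos_of_ne_zero (Finsupp.mem_support_iff.1 hi)
    omega
  intro k
  induction k with
  | zero =>
    intro f hf
    have : f = 0 := by
      ext e
      by_contra h
      exact absurd (hf e h) (by omega)
    rw [this]
    exact zero_mem _
  | succ k ih =>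
    intro f hf
    obtain ⟨D, hD⟩ := (mem_Lam_iff.1 f.2).2
    choose E hE using fun d : ℕ+ →₀ ℕ =>
      exists_expType ((Finsupp.toMultiset d).map (fun n : ℕ+ => (n : ℕ))) (by simp)
    let T : Set (ℕ+ →₀ ℕ) := {d | (Finsupp.toMultiset d).card = k ∧
      ((Finsupp.toMultiset d).map (fun n : ℕ+ => (n : ℕ))).sum ≤ D}
    have hT : T.Finite := by
      refine Set.Finite.of_injOn (f := fun d => (Finsupp.toMultiset d).map (fun n : ℕ+ => (n : ℕ)))
        (t := ((k • Multiset.range (D + 1)).powerset.toFinset : Finset (Multiset ℕ))) ?_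
        (fun d _ d' _ h => toMultiset_eq_of_expType h) (Finset.finite_toSet _)
      rintro d ⟨h1, h2⟩
      simp only [Finset.mem_coe, Multiset.mem_toFinset, Multiset.mem_powerset]
      refine Multiset.le_iff_count.2 fun a => ?_
      by_cases ha : a ∈ (Finsupp.toMultiset d).map (fun n : ℕ+ => (n : ℕ))
      · have h3 := Multiset.le_sum_of_mem ha
        have h4 : a ∈ Multiset.range (D + 1) := by rw [Multiset.mem_range]; omega
        have h5 := Multiset.count_pos.2 h4
        rw [Multiset.count_nsmul]
        refine (Multiset.count_le_card _ _).trans ?_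
        rw [Multiset.card_map, h1]
        exact Nat.le_mul_of_pos_right _ h5
      · rw [Multiset.count_eq_zero.2 ha]
        exact Nat.zero_le _
    let q (d : ℕ+ →₀ ℕ) : MvPowerSeries ℕ K := ((Finsupp.toMultiset d).map (psumSeries K)).prod
    let F : MvPolynomial ℕ+ K := ∑ d ∈ hT.toFinset,
      MvPolynomial.monomial d (coeff (E d) (f : MvPowerSeries ℕ K) / coeff (E d) (q d))
    have hF : ∀ e, coeff e ((MvPolynomial.aeval (psum K) F : Lam K) : MvPowerSeries ℕ K)
        = ∑ d ∈ hT.toFinset,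
          coeff (E d) (f : MvPowerSeries ℕ K) / coeff (E d) (q d) * coeff e (q d) := by
      intro e
      simp only [F]
      rw [map_sum, AddSubmonoidClass.coe_finsetSum, map_sum]
      exact Finset.sum_congr rfl fun d _ => by rw [aeval_psum_monomial, coeff_smul]
    have hq (d : ℕ+ →₀ ℕ) : q d ∈ Lam K :=
      multiset_prod_mem _ fun x hx => by
        obtain ⟨n, _, rfl⟩ := Multiset.mem_map.1 hx
        exact psumSeries_mem K n
    have hg := ih (f - MvPolynomial.aeval (psum K) F) fun e he => by
      by_contra hk
      apply he
      rw [AddSubgroupClass.coe_sub, map_sub, hF, sub_eq_zero]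
      rcases lt_or_eq_of_le (not_lt.1 hk) with hlt | heq
      · rw [Finset.sum_eq_zero]
        · by_contra h
          exact absurd (hf e h) (by omega)
        · intro d hd
          have hd' : d ∈ T := by simpa using hd
          by_contra h
          have := (exists_of_coeff_ne_zero _ _ (right_ne_zero_of_mul h)).1
          have := hd'.1
          omega
      · obtain ⟨s, hs⟩ : ∃ s : Multiset ℕ+, s.map (fun n : ℕ+ => (n : ℕ)) = expType e := by
          exact CanLift.prf (expType e) fun a ha => expType_pos ha
        obtain ⟨d, rfl⟩ : ∃ d, Finsupp.toMultiset d = s :=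
          ⟨Multiset.toFinsupp s, Multiset.toFinsupp_toMultiset s⟩
        have key : ∀ d' ∈ hT.toFinset, d' ≠ d → coeff e (q d') = 0 := by
          intro d' hd' hne
          have hd'' : d' ∈ T := by simpa using hd'
          by_contra h
          have h2 := (exists_of_coeff_ne_zero _ _ h).2 (by rw [hd''.1, heq])
          rw [← hs] at h2
          exact hne (toMultiset_eq_of_expType h2.symm)
        by_cases hdT : d ∈ T
        · rw [Finset.sum_eq_single d]
          · have h1 : expType e = expType (E d) := by rw [hE, hs]
            rw [coeff_eq_of_expType_eq (hq d) h1, coeff_eq_of_expType_eq f.2 h1,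
              div_mul_cancel₀]
            exact coeff_ne_zero _ _ (hE d)
          · intro d' hd' hne
            rw [key d' hd' hne, mul_zero]
          · intro h
            simp [hdT] at h
        · rw [Finset.sum_eq_zero]
          · apply hD
            by_contra h
            apply hdT
            refine ⟨?_, ?_⟩
            · rw [heq, ← card_expType, ← hs, Multiset.card_map]
            · rw [hs, sum_expType]; omega
          · intro d' hd'
            rw [key d' hd' (by rintro rfl; simp at hd'; exact hdT hd'), mul_zero]
    have := add_mem hg (AlgHom.mem_range_self (MvPolynomial.aeval (psum K)) F)
    rwa [sub_add_cancel] at this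

/-- The isomorphism `K[p_1, p_2, …] ≃ Λ_K` over a field of characteristic zero. -/
noncomputable def psumEquiv (K : Type*) [Field K] [CharZero K] : MvPolynomial ℕ+ K ≃ₐ[K] Lam K :=
  AlgEquiv.ofBijective (MvPolynomial.aeval (psum K))
    ⟨aeval_psum_injective K, aeval_psum_surjective K⟩

theorem psumEquiv_apply (K : Type*) [Field K] [CharZero K] (F : MvPolynomial ℕ+ K) :
    psumEquiv K F = MvPolynomial.aeval (psum K) F := rfl

/-- The basis `(p_λ)` of `Λ_K`. The partition `λ` is given by its multiplicities: the index `d`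
stands for the partition with exactly `d n` parts equal to `n`, so that `p_λ = ∏_n p_n ^ (d n)`. -/
noncomputable def psumBasis (K : Type*) [Field K] [CharZero K] :
    Module.Basis (ℕ+ →₀ ℕ) K (Lam K) :=
  (MvPolynomial.basisMonomials ℕ+ K).map (psumEquiv K).toLinearEquiv

theorem psumBasis_apply (K : Type*) [Field K] [CharZero K] (d : ℕ+ →₀ ℕ) :
    psumBasis K d = d.prod fun n k => psum K n ^ k := by
  simp only [psumBasis, Module.Basis.map_apply, MvPolynomial.coe_basisMonomials,
    AlgEquiv.toLinearEquiv_apply]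
  rw [psumEquiv_apply, MvPolynomial.aeval_monomial, map_one, one_mul]

/-- `z_λ = ∏_n n ^ m_n(λ) * m_n(λ)!`. -/
def zee (d : ℕ+ →₀ ℕ) : ℕ := d.prod fun n k => (n : ℕ) ^ k * k.factorial

/-- The bilinear form on `Λ_K` with `⟨p_λ, p_μ⟩_b = δ_{λ,μ} z_λ b ^ ℓ(λ)`. -/
noncomputable def jackForm {K : Type*} [Field K] [CharZero K] (b : K) :
    LinearMap.BilinForm K (Lam K) :=
  open Classical in
  (psumBasis K).constr K fun d => (psumBasis K).constr K fun d' =>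
    if d = d' then (zee d : K) * b ^ d.degree else 0

theorem jackForm_psumBasis {K : Type*} [Field K] [CharZero K] (b : K) (d d' : ℕ+ →₀ ℕ)
    [Decidable (d = d')] :
    jackForm b (psumBasis K d) (psumBasis K d')
      = if d = d' then (zee d : K) * b ^ d.degree else 0 := by
  simp only [jackForm, Module.Basis.constr_basis]
  congr

/-- The monomial symmetric function `m_μ`: the sum of all monomials whose multiset of nonzero
exponents is the multiset of parts of `μ`. Partitions are represented by Young diagrams, with
`μ.rowLens = [μ_1, μ_2, …, μ_ℓ]`. -/
noncomputable def msymm (K : Type*) [CommRing K] (μ : YoungDiagram) : Lam K :=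
  ⟨ofCoeff fun e => if expType e = (μ.rowLens : Multiset ℕ) then 1 else 0, mem_Lam_iff.2
    ⟨fun σ e => by simp only [coeff_ofCoeff, expType_embDomain],
      (μ.rowLens : Multiset ℕ).sum, fun e he => by
        rw [coeff_ofCoeff, if_neg]
        intro h
        rw [← h, sum_expType] at he
        exact lt_irrefl _ he⟩⟩

/-- The dominance order: `DomLE μ lam` means `μ ≤ lam`, i.e. `|μ| = |lam|` and
`μ_1 + ⋯ + μ_k ≤ lam_1 + ⋯ + lam_k` for all `k`. -/
def DomLE (μ lam : YoungDiagram) : Prop :=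
  μ.card = lam.card ∧
    ∀ k : ℕ, ∑ i ∈ Finset.range k, μ.rowLen i ≤ ∑ i ∈ Finset.range k, lam.rowLen i

/-- `P` is the family `(P_λ^{(b)})_λ` of monic Jack symmetric functions in `Λ_{ℚ(b)}`, where the
indeterminate `b` is `RatFunc.X`: each `P_λ` is `m_λ` plus a linear combination of the `m_μ` with
`μ < λ` in the dominance order, and the `P_λ` are pairwise orthogonal for `⟨ , ⟩_b`. -/
structure IsJackFamily (P : YoungDiagram → Lam (RatFunc ℚ)) : Prop where
  triangular : ∀ lam, P lam - msymm (RatFunc ℚ) lam ∈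
    Submodule.span (RatFunc ℚ) (msymm (RatFunc ℚ) '' {μ | DomLE μ lam ∧ μ ≠ lam})
  orthogonal : ∀ lam μ, lam ≠ μ → jackForm (RatFunc.X : RatFunc ℚ) (P lam) (P μ) = 0

/-- `f ∈ Λ_{ℚ(b)}` can be specialized at the complex number `b₀`: none of its coefficients (with
respect to the monomial symmetric functions) has a pole at `b₀`. -/
def RegularAt (f : Lam (RatFunc ℚ)) (b₀ : ℂ) : Prop :=
  ∀ e : ℕ →₀ ℕ, (coeff e (f : MvPowerSeries ℕ (RatFunc ℚ))).denom.eval₂ (algebraMap ℚ ℂ) b₀ ≠ 0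

/-- The specialization of `f ∈ Λ_{ℚ(b)}` at `b = b₀`, an element of `Λ_ℂ`, obtained by evaluating
every coefficient (meaningful if `RegularAt f b₀`). -/
noncomputable def specialize (f : Lam (RatFunc ℚ)) (b₀ : ℂ) : Lam ℂ :=
  ⟨ofCoeff fun e => (coeff e (f : MvPowerSeries ℕ (RatFunc ℚ))).eval (algebraMap ℚ ℂ) b₀, by
    obtain ⟨h, D, hD⟩ := mem_Lam_iff.1 f.2
    refine mem_Lam_iff.2 ⟨fun σ e => ?_, D, fun e he => ?_⟩
    · rw [coeff_ofCoeff, coeff_ofCoeff, h]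
    · rw [coeff_ofCoeff, hD e he, RatFunc.eval_zero]⟩

end SymFn

namespace Heis

/-- The underlying space of the Fock space `F_α` of the Heisenberg algebra
`[a_m, a_n] = m δ_{m+n,0}`: the polynomial ring in the creation operators `a_{-n}`, `n ≥ 1`
(the variable `X n` is `a_{-n}`), with vacuum vector `|α⟩ = 1`. -/
abbrev Fock : Type := MvPolynomial ℕ+ ℂ

/-- A positive integer as an element of `ℕ+`. -/
def toPNat (n : ℤ) (h : 0 < n) : ℕ+ := ⟨n.toNat, by omega⟩

theorem toPNat_coe (n : ℕ+) (h : 0 < (n : ℤ)) : toPNat n h = n := by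
  apply PNat.coe_injective
  simp [toPNat]

/-- The action of `a_n` on `F_α`: `a_{-n}` (for `n ≥ 1`) is multiplication by `X n`, `a_0` is the
scalar `α`, and `a_n` (for `n ≥ 1`) is `n ∂/∂(X n)`. -/
noncomputable def a (α : ℂ) (n : ℤ) : Module.End ℂ Fock :=
  if h : 0 < n then
    (n : ℂ) • (MvPolynomial.pderiv (toPNat n h)).toLinearMap
  else if h' : n < 0 then
    LinearMap.mulLeft ℂ (MvPolynomial.X (toPNat (-n) (by omega)))
  else α • LinearMap.id

theorem a_pos (α : ℂ) (n : ℕ+) (v : Fock) : a α n v = (n : ℂ) • MvPolynomial.pderiv n v := by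
  have h : 0 < (n : ℤ) := by exact_mod_cast n.pos
  rw [a, dif_pos h, toPNat_coe, LinearMap.smul_apply]
  simp

theorem a_neg (α : ℂ) (n : ℕ+) (v : Fock) : a α (-(n : ℤ)) v = MvPolynomial.X n * v := by
  have h : 0 < (n : ℤ) := by exact_mod_cast n.pos
  rw [a, dif_neg (by omega), dif_pos (by omega)]
  simp only [neg_neg, toPNat_coe, LinearMap.mulLeft_apply]

theorem a_zero (α : ℂ) (v : Fock) : a α 0 v = α • v := by
  simp [a]

/-- The normally ordered product `:a_m a_k:` (the operator of larger index stands to the right). -/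
noncomputable def normalOrdered (α : ℂ) (m k : ℤ) : Module.End ℂ Fock :=
  if m ≤ k then a α m * a α k else a α k * a α m

/-- The bosonized Virasoro generator
`L_n = (1/2) ∑_{m ∈ ℤ} :a_m a_{n-m}: - (n+1) ρ a_n`, as an operator on `F_α`; applied to a vector,
only finitely many terms of the sum are nonzero. -/
noncomputable def vir (α ρ : ℂ) (n : ℤ) (v : Fock) : Fock :=
  (1 / 2 : ℂ) • (∑ᶠ m : ℤ, normalOrdered α m (n - m) v) - (((n : ℂ) + 1) * ρ) • a α n v

/-- Every vector of `F_α` is killed by all `a_n` with `n` large. -/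
theorem exists_a_eq_zero (v : Fock) : ∃ N : ℤ, 0 ≤ N ∧ ∀ (α : ℂ) (n : ℤ), N < n → a α n v = 0 := by
  refine ⟨((v.vars.sup fun n : ℕ+ => (n : ℕ) : ℕ) : ℤ), by positivity, fun α n hn => ?_⟩
  have h0 : 0 < n := lt_of_le_of_lt (by positivity) hn
  have hv : toPNat n h0 ∉ v.vars := by
    intro h
    have h1 := Finset.le_sup (f := fun n : ℕ+ => (n : ℕ)) h
    simp only [toPNat, PNat.mk_coe] at h1
    omega
  have hn' : n = (toPNat n h0 : ℤ) := by
    change n = (n.toNat : ℤ)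
    omega
  rw [hn', a_pos, MvPolynomial.pderiv_eq_zero_of_notMem_vars hv, smul_zero]

theorem normalOrdered_eq_zero {α : ℂ} {v : Fock} {N : ℤ} (hN : ∀ n : ℤ, N < n → a α n v = 0)
    {m k : ℤ} (h : N < m ∨ N < k) : normalOrdered α m k v = 0 := by
  unfold normalOrdered
  split_ifs
  · rw [Module.End.mul_apply, hN k (by omega), map_zero]
  · rw [Module.End.mul_apply, hN m (by omega), map_zero]

/-- The sum defining `L_n v` has finitely many nonzero terms. -/
theorem vir_support_finite (α : ℂ) (n : ℤ) (v : Fock) :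
    (Function.support fun m : ℤ => normalOrdered α m (n - m) v).Finite := by
  obtain ⟨N, -, hN⟩ := exists_a_eq_zero v
  refine (Set.finite_Icc (n - N) N).subset fun m hm => ?_
  by_contra hc
  refine hm (normalOrdered_eq_zero (hN α) ?_)
  rw [Set.mem_Icc] at hc
  omega

theorem exists_vir_eq_zero (v : Fock) :
    ∃ N : ℤ, ∀ (α ρ : ℂ) (n : ℤ), N < n → vir α ρ n v = 0 := by
  obtain ⟨N, h0, hN⟩ := exists_a_eq_zero v
  refine ⟨2 * N, fun α ρ n hn => ?_⟩
  have h (m : ℤ) : normalOrdered α m (n - m) v = 0 :=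
    normalOrdered_eq_zero (hN α) (by omega)
  simp [vir, h, hN α n (by omega)]

theorem finite_of_eq_zero {f : ℕ+ → Fock} {N : ℤ} (h : ∀ n : ℕ+, N < (n : ℤ) → f n = 0) :
    (Function.support f).Finite := by
  refine Set.Finite.subset (Set.Finite.preimage (f := fun n : ℕ+ => (n : ℤ))
    (fun x _ y _ hxy => by simpa using hxy) (Set.finite_Icc 0 N)) fun n hn => ?_
  by_contra hc
  refine hn (h n ?_)
  simp only [Set.mem_preimage, Set.mem_Icc] at hc
  omega

/-- The positive square root of two, as a complex number. -/
noncomputable def sqrtTwo : ℂ := ((Real.sqrt 2 : ℝ) : ℂ)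

/-- The background charge `ρ = (β^{1/2} - β^{-1/2}) / √2`, where `s = β^{1/2}`. -/
noncomputable def rho (s : ℂ) : ℂ := (s - s⁻¹) / sqrtTwo

/-- The operator `Ê_β = √(2β) ∑_{n>0} a_{-n} L_n + ∑_{n>0} a_{-n} a_n (β - 1 - √(2β) a_0)`
on `F_α`, where `β = s ^ 2`, `√(2β) = √2 s` and `L_n` is taken at `ρ = (s - s⁻¹) / √2`; applied to
a vector, only finitely many terms of both sums are nonzero. -/
noncomputable def splitOp (α s : ℂ) (v : Fock) : Fock :=
  (sqrtTwo * s) • (∑ᶠ n : ℕ+, a α (-(n : ℤ)) (vir α (rho s) n v)) +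
    ∑ᶠ n : ℕ+, a α (-(n : ℤ)) (a α n ((s ^ 2 - 1) • v - (sqrtTwo * s) • a α 0 v))

/-- The two sums defining `Ê_β v` have finitely many nonzero terms. -/
theorem splitOp_support_finite (α s : ℂ) (v : Fock) :
    (Function.support fun n : ℕ+ => a α (-(n : ℤ)) (vir α (rho s) n v)).Finite ∧
    (Function.support fun n : ℕ+ =>
      a α (-(n : ℤ)) (a α n ((s ^ 2 - 1) • v - (sqrtTwo * s) • a α 0 v))).Finite := by
  obtain ⟨N, hN⟩ := exists_vir_eq_zero v
  obtain ⟨M, -, hM⟩ := exists_a_eq_zero ((s ^ 2 - 1) • v - (sqrtTwo * s) • a α 0 v)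
  exact ⟨finite_of_eq_zero (N := N) fun n hn => by rw [hN _ _ _ hn, map_zero],
    finite_of_eq_zero (N := M) fun n hn => by rw [hM _ _ hn, map_zero]⟩

/-- The isomorphism `ι_β : F_α → Λ_ℂ`, given by
`a_{-λ} |α⟩ ↦ (√(β/2)) ^ ℓ(λ) p_λ`, where `√(β/2) = s / √2`. -/
noncomputable def iota (s : ℂ) : Fock →ₐ[ℂ] SymFn.Lam ℂ :=
  MvPolynomial.aeval fun n => (s / sqrtTwo) • SymFn.psum ℂ n

theorem sqrtTwo_ne_zero : sqrtTwo ≠ 0 := by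
  simp [sqrtTwo]

theorem iota_bijective {s : ℂ} (hs : s ≠ 0) : Function.Bijective (iota s) := by
  have hc : s / sqrtTwo ≠ 0 := div_ne_zero hs sqrtTwo_ne_zero
  set c := s / sqrtTwo with hcdef
  let F : Fock →ₐ[ℂ] Fock := MvPolynomial.aeval fun n => c • MvPolynomial.X n
  let G : Fock →ₐ[ℂ] Fock := MvPolynomial.aeval fun n => c⁻¹ • MvPolynomial.X n
  have h1 : iota s = (SymFn.psumEquiv ℂ).toAlgHom.comp F := by
    refine MvPolynomial.algHom_ext fun n => ?_
    have : (SymFn.psumEquiv ℂ) (MvPolynomial.X n) = SymFn.psum ℂ n := by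
      rw [SymFn.psumEquiv_apply, MvPolynomial.aeval_X]
    simp [iota, F, this, ← hcdef]
  have hFG : ∀ v, F (G v) = v := fun v => by
    have : F.comp G = AlgHom.id ℂ _ := 
      MvPolynomial.algHom_ext fun n => by simp [F, G, smul_smul, hc]
    exact DFunLike.congr_fun this v
  have hGF : ∀ v, G (F v) = v := fun v => by
    have : G.comp F = AlgHom.id ℂ _ := 
      MvPolynomial.algHom_ext fun n => by simp [F, G, smul_smul, hc]
    exact DFunLike.congr_fun this v
  rw [h1]
  exact (SymFn.psumEquiv ℂ).bijective.comp
    (Function.bijective_iff_has_inverse.2 ⟨G, hGF, hFG⟩)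

/-- The vector `f ∈ F_α` with `ι_β f = P`, where `β = s ^ 2`. -/
noncomputable def iotaInv {s : ℂ} (hs : s ≠ 0) (P : SymFn.Lam ℂ) : Fock :=
  (AlgEquiv.ofBijective (iota s) (iota_bijective hs)).symm P

theorem iota_iotaInv {s : ℂ} (hs : s ≠ 0) (P : SymFn.Lam ℂ) : iota s (iotaInv hs P) = P :=
  (AlgEquiv.ofBijective (iota s) (iota_bijective hs)).apply_symm_apply P

/-- `ε_λ(β) = ∑_i (λ_i ^ 2 + β (1 - 2 i) λ_i)`; the row of index `i` (from `0`) is `λ_{i+1}`. -/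
noncomputable def eps (β : ℂ) (lam : YoungDiagram) : ℂ :=
  ∑ i ∈ Finset.range (lam.colLen 0),
    ((lam.rowLen i : ℂ) ^ 2 + β * (1 - 2 * ((i : ℂ) + 1)) * (lam.rowLen i : ℂ))

end Heis

/-! Under `iota` the operator `splitOp` becomes the Laplace–Beltrami (Calogero–Sutherland) operator
D on symmetric functions, in which α no longer appears. Three properties of D make the Jack
functions its eigenvectors.

Self-adjointness (`jackForm_lamOp`): for bβ = 1 the splitting part of D is adjoint to its joining
part, because multiplication by p_n is adjoint to b n ∂/∂p_n. Triangularity (`lamOp_msymm_sub_mem`):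
in finitely many variables D is an explicit differential operator, and the coefficient of x^e in D f
involves, besides that of x^e itself, only coefficients at exponents where units have moved from a
later to an earlier variable. Such moves go up in dominance order, so D m_λ is ε_λ m_λ plus lower
terms. Hence w = D P_λ − ε_λ P_λ is a combination of the P_μ with μ < λ, and by self-adjointness w
is orthogonal to those P_μ as well; since it is orthogonal to every P_μ and the form is
nondegenerate, w = 0 (`IsJackFamily.lamOp_eq`). No separation of eigenvalues is needed.

This takes place over ℚ(b) with β = b⁻¹. The coefficient formula `coeff_lamOp` is polynomial in β
and in the coefficients of f, so the eigenvalue equation survives evaluation at any b where P_λ has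
no pole (`lamOp_specialize`).

The three forms of D (power sums, finitely many variables, Fock space) are identified by one device:
each kills constants and has the same commutator with multiplication by a generator
(`laplaceBeltrami_X_mul`, `splitOp_X_mul`), so induction on polynomials applies. -/

namespace SymFn

/-! ### The Laplace–Beltrami operator in power sums and its commutator with p_k. -/

section LaplaceBeltrami

open MvPolynomial

variable {K : Type*} [Field K]

/-- The pairs of positive integers with sum `n`. -/
def pairs (n : ℕ+) : Finset (ℕ+ × ℕ+) :=
  (Finset.Iio n ×ˢ Finset.Iio n).filter fun x => x.1 + x.2 = n

theorem mem_pairs {n : ℕ+} {x : ℕ+ × ℕ+} : x ∈ pairs n ↔ x.1 + x.2 = n := by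
  simp only [pairs, Finset.mem_filter, Finset.mem_product, Finset.mem_Iio, and_iff_right_iff_imp]
  rintro rfl
  exact ⟨PNat.lt_add_right _ _, PNat.lt_add_left _ _⟩

theorem sum_pairs {M : Type*} [AddCommMonoid M] (f : ℕ → ℕ → M) (n : ℕ+) :
    ∑ x ∈ pairs n, f x.1 x.2 = ∑ i ∈ Finset.range ((n : ℕ) - 1), f (i + 1) ((n : ℕ) - 1 - i) := by
  refine Finset.sum_bij' (fun x _ => (x.1 : ℕ) - 1)
    (fun i hi => (i.succPNat, ⟨(n : ℕ) - 1 - i, by rw [Finset.mem_range] at hi; omega⟩))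
    ?_ ?_ ?_ ?_ ?_
  · rintro ⟨i, j⟩ h
    have h := congrArg PNat.val (mem_pairs.1 h)
    have := i.pos; have := j.pos
    simp only [Finset.mem_range]
    change (i : ℕ) + j = n at h
    omega
  · intro i hi
    rw [Finset.mem_range] at hi
    rw [mem_pairs]
    apply PNat.coe_injective
    change i + 1 + ((n : ℕ) - 1 - i) = n
    omega
  · rintro ⟨i, j⟩ h
    have h := congrArg PNat.val (mem_pairs.1 h)
    change (i : ℕ) + j = n at h
    have := i.pos; have := j.pos
    refine Prod.ext (PNat.coe_injective ?_) (PNat.coe_injective ?_)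
    · simp only [Nat.succPNat_coe]; omega
    · simp only [PNat.mk_coe]; omega
  · intro i hi
    simp
  · rintro ⟨i, j⟩ h
    have h := congrArg PNat.val (mem_pairs.1 h)
    change (i : ℕ) + j = n at h
    have := i.pos; have := j.pos
    congr 1 <;> dsimp only <;> omega

theorem exists_forall_pderiv_eq_zero (F : MvPolynomial ℕ+ K) :
    ∃ M : ℕ+, ∀ n, M < n → pderiv n F = 0 := by
  refine ⟨F.vars.sup id + 1, fun n hn => pderiv_eq_zero_of_notMem_vars fun h => ?_⟩
  have h1 : n ≤ F.vars.sup id := Finset.le_sup (f := id) h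
  exact absurd (hn.trans_le h1) (not_lt.2 (PNat.lt_add_right _ _).le)

theorem pderiv_comm {σ : Type*} (i j : σ) (F : MvPolynomial σ K) :
    pderiv i (pderiv j F) = pderiv j (pderiv i F) := by
  classical
  induction F using MvPolynomial.induction_on with
  | C c => simp
  | add F G hF hG => simp only [map_add, hF, hG]
  | mul_X F k hF =>
    simp only [pderiv_mul, pderiv_X, map_add, hF, Pi.single_apply, mul_ite, mul_one, mul_zero]
    split_ifs <;> (try simp only [map_zero]) <;> ring

theorem finite_support_pderiv (g : ℕ+ → MvPolynomial ℕ+ K) (F : MvPolynomial ℕ+ K) :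
    (Function.support fun n => g n * pderiv n F).Finite := by
  obtain ⟨M, hM⟩ := exists_forall_pderiv_eq_zero F
  refine (Set.finite_Iic M).subset fun n hn => ?_
  by_contra h
  exact hn (by simp only; rw [hM n (not_le.1 h), mul_zero])

/-- The sum is finite on each polynomial and satisfies the Leibniz rule, so it is a derivation, and
derivations agreeing on the variables are equal. -/
theorem mkDerivation_eq_finsum (g : ℕ+ → MvPolynomial ℕ+ K) (F : MvPolynomial ℕ+ K) :
    mkDerivation K g F = ∑ᶠ n, g n * pderiv n F := by
  let D : Derivation K (MvPolynomial ℕ+ K) (MvPolynomial ℕ+ K) :=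
    { toFun := fun F => ∑ᶠ n, g n * pderiv n F
      map_add' := fun F G => by
        simp only [map_add, mul_add]
        exact finsum_add_distrib (finite_support_pderiv g F) (finite_support_pderiv g G)
      map_smul' := fun c F => by
        simp only [Derivation.map_smul, mul_smul_comm, RingHom.id_apply]
        exact (smul_finsum c _).symm
      map_one_eq_zero' := by simp
      leibniz' := fun F G => by
        simp only [LinearMap.coe_mk, AddHom.coe_mk, smul_eq_mul]
        rw [mul_finsum' _ _ (finite_support_pderiv g G), mul_finsum' _ _ (finite_support_pderiv g F),
          ← finsum_add_distrib]
        · refine finsum_congr fun n => ?_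
          rw [Derivation.leibniz, smul_eq_mul, smul_eq_mul]; ring
        · have h := finite_support_pderiv (fun n => F * g n) G
          simp only [mul_assoc] at h
          exact h
        · have h := finite_support_pderiv (fun n => G * g n) F
          simp only [mul_assoc] at h
          exact h }
  have : mkDerivation K g = D := derivation_ext fun k => by
    classical
    rw [mkDerivation_X]
    change _ = ∑ᶠ n, g n * pderiv n (X k)
    rw [finsum_eq_single _ k fun n hn => by rw [pderiv_X_of_ne hn.symm, mul_zero], pderiv_X_self,
      mul_one]
  rw [this]
  rfl

/-- The derivation `∑_i i X_{i+k} ∂_i`. -/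
noncomputable def shiftDer (k : ℕ+) : Derivation K (MvPolynomial ℕ+ K) (MvPolynomial ℕ+ K) :=
  mkDerivation K fun i => ((i : ℕ) : K) • X (i + k)

/-- The splitting and joining operator `i j X_{i+j} ∂_i ∂_j + β (i + j) X_i X_j ∂_{i+j}`. -/
noncomputable def cubicTerm (β : K) (x : ℕ+ × ℕ+) : Module.End K (MvPolynomial ℕ+ K) :=
  (((x.1 : ℕ) * (x.2 : ℕ) : ℕ) : K) • (LinearMap.mulLeft K (X (x.1 + x.2)) ∘ₗ
      (pderiv x.1).toLinearMap ∘ₗ (pderiv x.2).toLinearMap) +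
    (β * ((x.1 : ℕ) + (x.2 : ℕ) : ℕ)) • (LinearMap.mulLeft K (X x.1 * X x.2) ∘ₗ
      (pderiv (x.1 + x.2)).toLinearMap)

theorem cubicTerm_apply (β : K) (x : ℕ+ × ℕ+) (F : MvPolynomial ℕ+ K) :
    cubicTerm β x F = (((x.1 : ℕ) * (x.2 : ℕ) : ℕ) : K) • (X (x.1 + x.2) *
        pderiv x.1 (pderiv x.2 F)) +
      (β * ((x.1 : ℕ) + (x.2 : ℕ) : ℕ)) • (X x.1 * X x.2 * pderiv (x.1 + x.2) F) := rfl

theorem finite_support_cubicTerm (β : K) (F : MvPolynomial ℕ+ K) :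
    (Function.support fun x => cubicTerm β x F).Finite := by
  obtain ⟨M, hM⟩ := exists_forall_pderiv_eq_zero F
  refine ((Set.finite_Iic M).prod (Set.finite_Iic M)).subset fun x hx => ?_
  by_contra h
  refine hx ?_
  have h2 : pderiv (x.1 + x.2) F = 0 ∧ pderiv x.1 (pderiv x.2 F) = 0 := by
    simp only [Set.mem_prod, Set.mem_Iic, not_and_or, not_le] at h
    rcases h with h | h
    · exact ⟨hM _ (h.trans (PNat.lt_add_right _ _)), by rw [pderiv_comm, hM _ h, map_zero]⟩
    · exact ⟨hM _ (h.trans (PNat.lt_add_left _ _)), by rw [hM _ h, map_zero]⟩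
  simp only [cubicTerm_apply, h2, mul_zero, smul_zero, add_zero]

/-- The number operator `n ^ 2 X_n ∂_n`. -/
noncomputable def quadTerm (n : ℕ+) : Module.End K (MvPolynomial ℕ+ K) :=
  ((n : ℕ) : K) ^ 2 • (LinearMap.mulLeft K (X n) ∘ₗ (pderiv n).toLinearMap)

theorem quadTerm_apply (n : ℕ+) (F : MvPolynomial ℕ+ K) :
    quadTerm n F = ((n : ℕ) : K) ^ 2 • (X n * pderiv n F) := rfl

theorem finite_support_quadTerm (F : MvPolynomial ℕ+ K) :
    (Function.support fun n => quadTerm n F).Finite := by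
  simpa only [quadTerm_apply, ← smul_mul_assoc] using
    finite_support_pderiv (fun n : ℕ+ => ((n : ℕ) : K) ^ 2 • X n) F

/-- The Laplace–Beltrami (Calogero–Sutherland) operator in the power sums `X n = p_n`:
`∑_{i,j} (i j p_{i+j} ∂_i ∂_j + β (i + j) p_i p_j ∂_{i+j}) + (1 - β) ∑_n n ^ 2 p_n ∂_n`. -/
noncomputable def laplaceBeltrami (β : K) : Module.End K (MvPolynomial ℕ+ K) where
  toFun F := ∑ᶠ x, cubicTerm β x F + (1 - β) • ∑ᶠ n, quadTerm n F
  map_add' F G := by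
    simp only [map_add]
    rw [finsum_add_distrib (finite_support_cubicTerm β F) (finite_support_cubicTerm β G),
      finsum_add_distrib (finite_support_quadTerm F) (finite_support_quadTerm G), smul_add]
    abel
  map_smul' c F := by
    simp only [map_smul, RingHom.id_apply]
    rw [← smul_finsum, ← smul_finsum, smul_add, smul_comm]

theorem laplaceBeltrami_apply (β : K) (F : MvPolynomial ℕ+ K) :
    laplaceBeltrami β F = ∑ᶠ x, cubicTerm β x F + (1 - β) • ∑ᶠ n, quadTerm n F := rfl

theorem laplaceBeltrami_one (β : K) : laplaceBeltrami β (1 : MvPolynomial ℕ+ K) = 0 := by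
  simp [laplaceBeltrami_apply, cubicTerm_apply, quadTerm_apply]

theorem finsum_ite_snd {M : Type*} [AddCommMonoid M] (k : ℕ+) (g : ℕ+ → M) :
    ∑ᶠ x : ℕ+ × ℕ+, (if x.2 = k then g x.1 else 0) = ∑ᶠ i, g i := by
  classical
  have hinj : Function.Injective fun i : ℕ+ => (i, k) := fun i j h => (Prod.ext_iff.1 h).1
  rw [← finsum_mem_range (f := fun x : ℕ+ × ℕ+ => g x.1) hinj]
  refine finsum_congr fun x => ?_
  rw [finsum_eq_if]
  congr 1
  simp only [Set.mem_range, Prod.ext_iff, exists_eq_left, eq_iff_iff]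
  exact eq_comm

theorem finsum_ite_fst {M : Type*} [AddCommMonoid M] (k : ℕ+) (g : ℕ+ → M) :
    ∑ᶠ x : ℕ+ × ℕ+, (if x.1 = k then g x.2 else 0) = ∑ᶠ i, g i := by
  rw [← finsum_ite_snd k g, ← finsum_comp_equiv (Equiv.prodComm ℕ+ ℕ+)]
  rfl

/-- The second-order part contributes first-order terms whenever one of its two derivatives hits X
k; the first-order part contributes a multiplication operator. For i = j = k both first-order terms
occur, and no ∂_i∂_j X_k term arises since X k is linear. -/
theorem cubicTerm_X_mul (β : K) (x : ℕ+ × ℕ+) (k : ℕ+) (F : MvPolynomial ℕ+ K) :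
    cubicTerm β x (X k * F) = X k * cubicTerm β x F +
      ((k : ℕ) : K) • (if x.2 = k then (((x.1 : ℕ) : K) • X (x.1 + k)) * pderiv x.1 F else 0) +
      ((k : ℕ) : K) • (if x.1 = k then (((x.2 : ℕ) : K) • X (x.2 + k)) * pderiv x.2 F else 0) +
      (β * (k : ℕ)) • (if x.1 + x.2 = k then X x.1 * X x.2 * F else 0) := by
  classical
  obtain ⟨i, j⟩ := x
  have hder (n : ℕ+) (G : MvPolynomial ℕ+ K) :
      pderiv n (X k * G) = X k * pderiv n G + if n = k then G else 0 := by
    rw [Derivation.leibniz, smul_eq_mul, smul_eq_mul, pderiv_X, Pi.single_apply]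
    split_ifs with h1 h2 <;> simp_all
  have hij : pderiv i (pderiv j (X k * F)) = X k * pderiv i (pderiv j F) +
      (if i = k then pderiv j F else 0) + (if j = k then pderiv i F else 0) := by
    rw [hder, map_add, hder]
    congr 1
    split_ifs <;> simp
  simp only [cubicTerm_apply]
  rw [hij, hder]
  have e1 : (((i : ℕ) * (j : ℕ) : ℕ) : K) • (X (i + j) * (if i = k then pderiv j F else 0)) =
      ((k : ℕ) : K) • (if i = k then (((j : ℕ) : K) • X (j + k)) * pderiv j F else 0) := by
    split_ifs with h
    · subst h
      rw [smul_mul_assoc, smul_smul, Nat.cast_mul, add_comm i j]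
    · simp
  have e2 : (((i : ℕ) * (j : ℕ) : ℕ) : K) • (X (i + j) * (if j = k then pderiv i F else 0)) =
      ((k : ℕ) : K) • (if j = k then (((i : ℕ) : K) • X (i + k)) * pderiv i F else 0) := by
    split_ifs with h
    · subst h
      rw [smul_mul_assoc, smul_smul, Nat.cast_mul, mul_comm]
    · simp
  have e3 : (β * ((i : ℕ) + (j : ℕ) : ℕ)) • (X i * X j * (if i + j = k then F else 0)) =
      (β * (k : ℕ)) • (if i + j = k then X i * X j * F else 0) := by
    split_ifs with h
    · subst h; rw [PNat.add_coe]
    · simp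
  rw [← e1, ← e2, ← e3]
  simp only [mul_add, smul_add, mul_smul_comm, mul_left_comm (X k)]
  abel

theorem quadTerm_X_mul (n k : ℕ+) (F : MvPolynomial ℕ+ K) :
    quadTerm n (X k * F) = X k * quadTerm n F +
      if n = k then ((k : ℕ) : K) ^ 2 • (X k * F) else 0 := by
  classical
  rw [quadTerm_apply, quadTerm_apply, Derivation.leibniz, pderiv_X, Pi.single_apply]
  by_cases h : n = k
  · subst h
    simp only [if_true, smul_eq_mul, mul_one, mul_add, smul_add, mul_smul_comm]
  · simp [h, Ne.symm h, mul_left_comm (X k)]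

/-- The commutator of the operator with p_k. The cases x.1 = k and x.2 = k each give one copy of
`shiftDer`, hence the factor 2. Together with `laplaceBeltrami_one` this recursion determines the
operator. -/
theorem laplaceBeltrami_X_mul (β : K) (k : ℕ+) (F : MvPolynomial ℕ+ K) :
    laplaceBeltrami β (X k * F) = X k * laplaceBeltrami β F +
      (β * (k : ℕ)) • ((∑ x ∈ pairs k, X x.1 * X x.2) * F) +
      ((1 - β) * ((k : ℕ) : K) ^ 2) • (X k * F) + (2 * ((k : ℕ) : K)) • shiftDer k F := by
  have hfin1 : (Function.support fun x : ℕ+ × ℕ+ =>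
      if x.2 = k then (((x.1 : ℕ) : K) • X (x.1 + k)) * pderiv x.1 F else 0).Finite := by
    obtain ⟨M, hM⟩ := exists_forall_pderiv_eq_zero F
    refine ((Set.finite_Iic M).prod (Set.finite_singleton k)).subset fun x hx => ?_
    by_contra h
    refine hx ?_
    simp only [Set.mem_prod, Set.mem_Iic, Set.mem_singleton_iff, not_and_or, not_le] at h
    rcases h with h | h
    · simp [hM _ h]
    · simp [h]
  have hfin2 : (Function.support fun x : ℕ+ × ℕ+ =>
      if x.1 = k then (((x.2 : ℕ) : K) • X (x.2 + k)) * pderiv x.2 F else 0).Finite := by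
    obtain ⟨M, hM⟩ := exists_forall_pderiv_eq_zero F
    refine ((Set.finite_singleton k).prod (Set.finite_Iic M)).subset fun x hx => ?_
    by_contra h
    refine hx ?_
    simp only [Set.mem_prod, Set.mem_Iic, Set.mem_singleton_iff, not_and_or, not_le] at h
    rcases h with h | h
    · simp [h]
    · simp [hM _ h]
  have hsub : (Function.support fun x : ℕ+ × ℕ+ =>
      if x.1 + x.2 = k then X x.1 * X x.2 * F else 0) ⊆ (pairs k : Set (ℕ+ × ℕ+)) := by
    intro x hx
    by_contra h
    rw [Finset.mem_coe, mem_pairs] at h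
    exact hx (if_neg h)
  have hfin3 := (pairs k).finite_toSet.subset hsub
  have hsmul {f : ℕ+ × ℕ+ → MvPolynomial ℕ+ K} (c : K) (h : (Function.support f).Finite) :
      (Function.support fun x => c • f x).Finite :=
    h.subset fun x hx hx' => hx (by simp only; rw [hx', smul_zero])
  have hmul : (Function.support fun x => X k * cubicTerm β x F).Finite :=
    (finite_support_cubicTerm β F).subset fun x hx hx' => hx (by
      simp only at hx' ⊢; rw [hx', mul_zero])
  have hmul' : (Function.support fun x => X k * quadTerm x F).Finite :=
    (finite_support_quadTerm F).subset fun x hx hx' => hx (by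
      simp only at hx' ⊢; rw [hx', mul_zero])
  have hfin4 : (Function.support fun n : ℕ+ =>
      if n = k then ((k : ℕ) : K) ^ 2 • (X k * F) else 0).Finite :=
    (Set.finite_singleton k).subset fun n hn => by
      by_contra h
      exact hn (if_neg h)
  have hshift : shiftDer k F = ∑ᶠ i : ℕ+, (((i : ℕ) : K) • X (i + k)) * pderiv i F :=
    mkDerivation_eq_finsum _ _
  rw [laplaceBeltrami_apply, laplaceBeltrami_apply]
  simp only [cubicTerm_X_mul, quadTerm_X_mul]
  rw [finsum_add_distrib (((hmul.union (hsmul _ hfin1)).subset (Function.support_add _ _)).union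
      (hsmul _ hfin2) |>.subset (Function.support_add _ _)) (hsmul _ hfin3),
    finsum_add_distrib ((hmul.union (hsmul _ hfin1)).subset (Function.support_add _ _))
      (hsmul _ hfin2), finsum_add_distrib hmul (hsmul _ hfin1), finsum_add_distrib hmul' hfin4,
    ← smul_finsum, ← smul_finsum, ← smul_finsum,
    finsum_ite_snd k fun i : ℕ+ => (((i : ℕ) : K) • X (i + k)) * pderiv i F,
    finsum_ite_fst k fun i : ℕ+ => (((i : ℕ) : K) • X (i + k)) * pderiv i F, ← hshift,
    finsum_eq_single _ k fun n hn => if_neg hn, if_pos rfl,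
    finsum_eq_sum_of_support_subset _ hsub,
    Finset.sum_congr rfl fun x hx => if_pos (mem_pairs.1 hx), ← Finset.sum_mul,
    ← mul_finsum' _ _ (finite_support_cubicTerm β F),
    ← mul_finsum' _ _ (finite_support_quadTerm F)]
  simp only [smul_eq_C_mul, map_mul, map_sub, map_one, map_pow, map_ofNat]
  ring

end LaplaceBeltrami

/-! ### Self-adjointness for the Jack scalar product. -/

section Adjoint

open MvPolynomial

variable {K : Type*} [Field K] [CharZero K]

theorem zee_add_single (d : ℕ+ →₀ ℕ) (n : ℕ+) :
    zee (d + Finsupp.single n 1) = n * (d n + 1) * zee d := by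
  have key (d : ℕ+ →₀ ℕ) : (n : ℕ) ^ d n * (d n).factorial *
      (d.erase n).prod (fun n k => (n : ℕ) ^ k * k.factorial) = zee d :=
    Finsupp.mul_prod_erase' d n (fun n k => (n : ℕ) ^ k * k.factorial) (by simp)
  have he : (d + Finsupp.single n 1).erase n = d.erase n := by
    ext i
    by_cases h : i = n
    · simp [h]
    · simp [Finsupp.erase_ne h]
  rw [← key, ← key d, he]
  simp only [Finsupp.add_apply, Finsupp.single_eq_same, pow_succ, Nat.factorial_succ]
  ring

theorem zee_pos (d : ℕ+ →₀ ℕ) : 0 < zee d :=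
  Finset.prod_pos fun n _ => Nat.mul_pos (pow_pos n.pos _) (Nat.factorial_pos _)

open Classical in
theorem jackForm_monomial (b : K) (d d' : ℕ+ →₀ ℕ) (c c' : K) :
    jackForm b (psumEquiv K (monomial d c)) (psumEquiv K (monomial d' c')) =
      c * c' * if d = d' then (zee d : K) * b ^ d.degree else 0 := by
  have h (d : ℕ+ →₀ ℕ) (c : K) : psumEquiv K (monomial d c) = c • psumBasis K d := by
    rw [← mul_one c, ← smul_eq_mul, ← smul_monomial, map_smul]
    simp [psumBasis]
  rw [h, h, map_smul, map_smul, LinearMap.smul_apply, jackForm_psumBasis]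
  simp only [smul_eq_mul]
  ring

theorem jackForm_comm (b : K) (f g : Lam K) : jackForm b f g = jackForm b g f := by
  classical
  obtain ⟨F, rfl⟩ := (psumEquiv K).surjective f
  obtain ⟨G, rfl⟩ := (psumEquiv K).surjective g
  induction F using MvPolynomial.induction_on' with
  | add F F' hF hF' => simp only [map_add, LinearMap.add_apply, hF, hF']
  | monomial d c =>
    induction G using MvPolynomial.induction_on' with
    | add G G' hG hG' => simp only [map_add, LinearMap.add_apply, hG, hG']
    | monomial d' c' =>
      rw [jackForm_monomial, jackForm_monomial]
      by_cases h : d = d'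
      · subst h; ring
      · simp [h, Ne.symm h]

/-- Multiplication by `p_n` is adjoint to `b n ∂/∂p_n`. -/
theorem jackForm_X_mul (b : K) (n : ℕ+) (F G : MvPolynomial ℕ+ K) :
    jackForm b (psumEquiv K (X n * F)) (psumEquiv K G) =
      b * (n : ℕ) * jackForm b (psumEquiv K F) (psumEquiv K (pderiv n G)) := by
  classical
  induction F using MvPolynomial.induction_on' with
  | add F F' hF hF' => simp only [mul_add, map_add, LinearMap.add_apply, hF, hF']
  | monomial d c =>
    induction G using MvPolynomial.induction_on' with
    | add G G' hG hG' => simp only [mul_add, map_add, hG, hG']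
    | monomial d' c' =>
      rw [mul_comm, X, monomial_mul, mul_one, pderiv_monomial, jackForm_monomial,
        jackForm_monomial]
      by_cases h : d + Finsupp.single n 1 = d'
      · subst h
        rw [if_pos rfl, if_pos (by simp), zee_add_single, map_add, Finsupp.degree_single]
        simp only [Finsupp.add_apply, Finsupp.single_eq_same]
        push_cast
        ring
      · rw [if_neg h]
        by_cases h0 : d' n = 0
        · simp [h0]
        · rw [if_neg]
          · simp
          · rintro rfl
            refine h (tsub_add_cancel_of_le ?_)
            exact Finsupp.single_le_iff.2 (Nat.one_le_iff_ne_zero.2 h0)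

theorem jackForm_mul_X (b : K) (n : ℕ+) (F G : MvPolynomial ℕ+ K) :
    jackForm b (psumEquiv K F) (psumEquiv K (X n * G)) =
      b * (n : ℕ) * jackForm b (psumEquiv K (pderiv n F)) (psumEquiv K G) := by
  rw [jackForm_comm, jackForm_X_mul, jackForm_comm]

/-- The two summands are exchanged by adjunction. Pairing ∂_i∂_j F with ∂_{i+j} G carries the weight
b i j (i+j) when the joining term acts on F, and β b² i j (i+j) when the splitting term acts on G;
these agree exactly when bβ = 1. -/
theorem jackForm_cubicTerm {b β : K} (h : b * β = 1) (x : ℕ+ × ℕ+) (F G : MvPolynomial ℕ+ K) :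
    jackForm b (psumEquiv K (cubicTerm β x F)) (psumEquiv K G) =
      jackForm b (psumEquiv K F) (psumEquiv K (cubicTerm β x G)) := by
  obtain ⟨i, j⟩ := x
  simp only [cubicTerm_apply, map_add, map_smul, LinearMap.add_apply, LinearMap.smul_apply,
    mul_assoc, jackForm_X_mul, jackForm_mul_X, smul_eq_mul, pderiv_comm j i, PNat.add_coe]
  push_cast
  linear_combination (b * (i * j * (i + j) : K)) *
    (jackForm b (psumEquiv K (pderiv (i + j) F)) (psumEquiv K (pderiv i (pderiv j G))) -
    jackForm b (psumEquiv K (pderiv i (pderiv j F))) (psumEquiv K (pderiv (i + j) G))) * h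

theorem jackForm_quadTerm (b : K) (n : ℕ+) (F G : MvPolynomial ℕ+ K) :
    jackForm b (psumEquiv K (quadTerm n F)) (psumEquiv K G) =
      jackForm b (psumEquiv K F) (psumEquiv K (quadTerm n G)) := by
  simp only [quadTerm_apply, map_smul, LinearMap.smul_apply, jackForm_X_mul, jackForm_mul_X]

theorem jackForm_finsum {ι : Type*} (b : K) {t : ι → Module.End K (MvPolynomial ℕ+ K)}
    (hfin : ∀ F, (Function.support fun i => t i F).Finite)
    (ht : ∀ i F G, jackForm b (psumEquiv K (t i F)) (psumEquiv K G) =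
      jackForm b (psumEquiv K F) (psumEquiv K (t i G))) (F G : MvPolynomial ℕ+ K) :
    jackForm b (psumEquiv K (∑ᶠ i, t i F)) (psumEquiv K G) =
      jackForm b (psumEquiv K F) (psumEquiv K (∑ᶠ i, t i G)) := by
  classical
  set s := (hfin F).toFinset ∪ (hfin G).toFinset
  rw [finsum_eq_sum_of_support_subset (s := s) _ (by simp [s]),
    finsum_eq_sum_of_support_subset (s := s) _ (by simp [s])]
  simp only [map_sum, LinearMap.sum_apply, ht]

theorem jackForm_laplaceBeltrami {b β : K} (h : b * β = 1) (F G : MvPolynomial ℕ+ K) :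
    jackForm b (psumEquiv K (laplaceBeltrami β F)) (psumEquiv K G) =
      jackForm b (psumEquiv K F) (psumEquiv K (laplaceBeltrami β G)) := by
  rw [laplaceBeltrami_apply, laplaceBeltrami_apply, map_add, map_add, map_add,
    LinearMap.add_apply, jackForm_finsum b (finite_support_cubicTerm β) (jackForm_cubicTerm h),
    map_smul, map_smul, LinearMap.smul_apply, map_add, map_smul, map_smul,
    jackForm_finsum b finite_support_quadTerm (jackForm_quadTerm b)]

/-- The power sum basis is orthogonal, and its norms z_λ b^ℓ(λ) are nonzero in characteristic zero.
-/
theorem eq_zero_of_jackForm_eq_zero {b : K} (hb : b ≠ 0) {f : Lam K}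
    (h : ∀ g, jackForm b f g = 0) : f = 0 := by
  classical
  refine (psumBasis K).repr.map_eq_zero_iff.1 (Finsupp.ext fun d => ?_)
  have h1 := h (psumBasis K d)
  rw [← (psumBasis K).linearCombination_repr f, Finsupp.linearCombination_apply, Finsupp.sum,
    map_sum, LinearMap.sum_apply, Finset.sum_eq_single d] at h1
  · rw [map_smul, LinearMap.smul_apply, jackForm_psumBasis, if_pos rfl, smul_eq_mul] at h1
    have h2 : (zee d : K) * b ^ d.degree ≠ 0 :=
      mul_ne_zero (Nat.cast_ne_zero.2 (zee_pos d).ne') (pow_ne_zero _ hb)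
    simpa [h2] using h1
  · intro d' _ hne
    rw [map_smul, LinearMap.smul_apply, jackForm_psumBasis, if_neg hne, smul_zero]
  · intro hd
    rw [Finsupp.notMem_support_iff.1 hd, zero_smul, map_zero, LinearMap.zero_apply]

/-- The Laplace–Beltrami operator on `Λ_K`. -/
noncomputable def lamOp (β : K) : Module.End K (Lam K) :=
  (psumEquiv K).toLinearMap ∘ₗ laplaceBeltrami β ∘ₗ (psumEquiv K).symm.toLinearMap

theorem lamOp_psumEquiv (β : K) (F : MvPolynomial ℕ+ K) :
    lamOp β (psumEquiv K F) = psumEquiv K (laplaceBeltrami β F) := by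
  simp [lamOp]

theorem jackForm_lamOp {b β : K} (h : b * β = 1) (f g : Lam K) :
    jackForm b (lamOp β f) g = jackForm b f (lamOp β g) := by
  obtain ⟨F, rfl⟩ := (psumEquiv K).surjective f
  obtain ⟨G, rfl⟩ := (psumEquiv K).surjective g
  rw [lamOp_psumEquiv, lamOp_psumEquiv, jackForm_laplaceBeltrami h]

end Adjoint

/-! ### The operator as a differential operator in finitely many variables. -/

section Finite

open MvPolynomial

variable {K : Type*} [Field K]

/-- The power sum `x_0 ^ n + ⋯ + x_{N-1} ^ n`. -/
noncomputable def finPsum (K : Type*) [Field K] (N n : ℕ) : MvPolynomial ℕ K :=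
  ∑ i ∈ Finset.range N, X i ^ n

/-- Restriction of a polynomial in power sums to the variables `x_0, …, x_{N-1}`. -/
noncomputable def finEval (K : Type*) [Field K] (N : ℕ) : MvPolynomial ℕ+ K →ₐ[K] MvPolynomial ℕ K :=
  aeval fun n => finPsum K N n

theorem finEval_X (N : ℕ) (n : ℕ+) : finEval K N (X n) = finPsum K N n := by
  rw [finEval, aeval_X]

theorem pderiv_finPsum {N i : ℕ} (hi : i < N) (n : ℕ) :
    pderiv i (finPsum K N n) = (n : MvPolynomial ℕ K) * X i ^ (n - 1) := by
  rw [finPsum, map_sum, Finset.sum_eq_single i]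
  · rw [pderiv_pow, pderiv_X_self, mul_one]
  · intro j _ hj
    rw [pderiv_pow, pderiv_X_of_ne hj, mul_zero]
  · intro h
    exact absurd (Finset.mem_range.2 hi) h

/-- The Euler operator `x_i ∂/∂x_i`. -/
noncomputable def euler (i : ℕ) (f : MvPolynomial ℕ K) : MvPolynomial ℕ K := X i * pderiv i f

theorem euler_mul (i : ℕ) (f g : MvPolynomial ℕ K) :
    euler i (f * g) = f * euler i g + euler i f * g := by
  simp only [euler, pderiv_mul]; ring

theorem euler_add (i : ℕ) (f g : MvPolynomial ℕ K) :
    euler i (f + g) = euler i f + euler i g := by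
  simp only [euler, map_add]; ring

theorem euler_finPsum {N i : ℕ} (hi : i < N) (n : ℕ+) :
    euler i (finPsum K N n) = ((n : ℕ) : MvPolynomial ℕ K) * X i ^ (n : ℕ) := by
  rw [euler, pderiv_finPsum hi, mul_left_comm, ← pow_succ', Nat.sub_add_cancel n.pos]

theorem euler_X_pow (i n : ℕ) :
    euler i (X i ^ n : MvPolynomial ℕ K) = (n : MvPolynomial ℕ K) * X i ^ n := by
  rw [euler, pderiv_pow, pderiv_X_self, mul_one]
  cases n with
  | zero => simp
  | succ n => rw [Nat.add_sub_cancel, pow_succ]; ring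

theorem coeff_euler (i : ℕ) (f : MvPolynomial ℕ K) (e : ℕ →₀ ℕ) :
    coeff e (euler i f) = (e i : K) * coeff e f := by
  classical
  induction f using MvPolynomial.induction_on' with
  | add f g hf hg => rw [euler_add, coeff_add, coeff_add, hf, hg, mul_add]
  | monomial d c =>
    rw [euler, X_mul_pderiv_monomial, coeff_smul, coeff_monomial]
    split_ifs with h
    · rw [h, nsmul_eq_mul]
    · simp

/-- The vector field ∑ x_i^{n+1} ∂/∂x_i sends p_k to k p_{k+n}, just as `shiftDer` does on
generators. -/
theorem finEval_shiftDer (N : ℕ) (n : ℕ+) (F : MvPolynomial ℕ+ K) :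
    finEval K N (shiftDer n F) = ∑ i ∈ Finset.range N, X i ^ (n : ℕ) * euler i (finEval K N F) := by
  induction F using MvPolynomial.induction_on with
  | C c => simp [shiftDer, euler, finEval]
  | add F G hF hG =>
    simp only [map_add, hF, hG, euler_add, mul_add, Finset.sum_add_distrib]
  | mul_X F k hF =>
    rw [Derivation.leibniz, smul_eq_mul, smul_eq_mul, map_add, map_mul, map_mul, map_mul, hF,
      finEval_X, shiftDer, mkDerivation_X, map_smul, finEval_X]
    have (i : ℕ) (hi : i ∈ Finset.range N) :
        X i ^ (n : ℕ) * euler i (finEval K N F * finPsum K N k) =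
          finPsum K N k * (X i ^ (n : ℕ) * euler i (finEval K N F)) +
          finEval K N F * (((k : ℕ) : MvPolynomial ℕ K) * X i ^ ((k : ℕ) + n)) := by
      rw [euler_mul, euler_finPsum (Finset.mem_range.1 hi), pow_add]; ring
    rw [Finset.sum_congr rfl this, Finset.sum_add_distrib, ← Finset.mul_sum, ← Finset.mul_sum,
      ← Finset.mul_sum, smul_eq_C_mul, map_natCast, finPsum, PNat.add_coe, finPsum]
    ring

/-- `∑_{i + j = n} x ^ i y ^ j` over positive `i` and `j`. -/
noncomputable def posHomog {R : Type*} [CommRing R] (n : ℕ+) (x y : R) : R :=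
  ∑ p ∈ pairs n, x ^ (p.1 : ℕ) * y ^ (p.2 : ℕ)

theorem posHomog_self {R : Type*} [CommRing R] (n : ℕ+) (x : R) :
    posHomog n x x = (((n : ℕ) : R) - 1) * x ^ (n : ℕ) := by
  have h : ∀ p ∈ pairs n, x ^ (p.1 : ℕ) * x ^ (p.2 : ℕ) = x ^ (n : ℕ) := fun p hp => by
    rw [← pow_add, ← PNat.add_coe, mem_pairs.1 hp]
  have h1 := sum_pairs (fun _ _ => (1 : ℕ)) n
  rw [posHomog, Finset.sum_congr rfl h, Finset.sum_const, Finset.card_eq_sum_ones, h1]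
  simp

/-- After a factor xy is taken out, `posHomog` is the geometric sum of degree n − 2; for n = 1 both
sides vanish. -/
theorem sub_mul_posHomog {R : Type*} [CommRing R] (n : ℕ+) (x y : R) :
    (x - y) * posHomog n x y = x * y * (x ^ ((n : ℕ) - 1) - y ^ ((n : ℕ) - 1)) := by
  rw [posHomog, sum_pairs fun i j => x ^ i * y ^ j, ← (Commute.all x y).geom_sum₂_mul,
    Finset.mul_sum, Finset.sum_mul, Finset.mul_sum]
  refine Finset.sum_congr rfl fun i hi => ?_
  rw [Finset.mem_range] at hi
  obtain ⟨m, hm⟩ : ∃ m, (n : ℕ) - 1 - i = m + 1 := ⟨(n : ℕ) - 1 - i - 1, by omega⟩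
  have h2 : (n : ℕ) - 1 - 1 - i = m := by omega
  rw [hm, h2]
  ring

theorem posHomog_comm {R : Type*} [CommRing R] (n : ℕ+) (x y : R) :
    posHomog n x y = posHomog n y x :=
  Finset.sum_bij' (fun p _ => p.swap) (fun p _ => p.swap)
    (fun p hp => by rw [mem_pairs] at *; rw [← hp]; exact add_comm _ _)
    (fun p hp => by rw [mem_pairs] at *; rw [← hp]; exact add_comm _ _)
    (fun _ _ => rfl) (fun _ _ => rfl) (fun _ _ => mul_comm _ _)

theorem sum_range_sum_range {M : Type*} [AddCommMonoid M] (g : ℕ → ℕ → M)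
    (hg : ∀ k l, g k l = g l k) (N : ℕ) :
    ∑ k ∈ Finset.range N, ∑ l ∈ Finset.range N, g k l =
      ∑ k ∈ Finset.range N, g k k +
        2 • ∑ l ∈ Finset.range N, ∑ k ∈ Finset.range l, g k l := by
  induction N with
  | zero => simp
  | succ N ih =>
    simp only [Finset.sum_range_succ, Finset.sum_add_distrib, ih,
      Finset.sum_congr rfl fun x _ => hg N x, smul_add, two_smul]
    abel

theorem finEval_sum_pairs (N : ℕ) (n : ℕ+) :
    finEval K N (∑ p ∈ pairs n, X p.1 * X p.2) =
      (((n : ℕ) : MvPolynomial ℕ K) - 1) * finPsum K N n +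
        2 * ∑ l ∈ Finset.range N, ∑ k ∈ Finset.range l, posHomog n (X k) (X l) := by
  have h : finEval K N (∑ p ∈ pairs n, X p.1 * X p.2) =
      ∑ k ∈ Finset.range N, ∑ l ∈ Finset.range N, posHomog n (X k) (X l) := by
    simp only [map_sum, map_mul, finEval_X, finPsum, Finset.sum_mul_sum, posHomog]
    rw [Finset.sum_comm]
    refine Finset.sum_congr rfl fun k _ => ?_
    rw [Finset.sum_comm]
  rw [h, sum_range_sum_range _ fun k l => posHomog_comm n _ _]
  simp only [posHomog_self, ← Finset.mul_sum, finPsum, nsmul_eq_mul, Nat.cast_ofNat]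

/-- The stable Calogero–Sutherland operator: with D_i = x_i ∂_i, it is ∑ D_i² + β ∑_{k<l} (x_k +
x_l)/(x_k − x_l) (D_k − D_l) − βN ∑ D_i. The divided difference of f must be a polynomial, so the
quotients h are carried through the induction instead of dividing. -/
theorem exists_finEval_laplaceBeltrami (β : K) (N : ℕ) (F : MvPolynomial ℕ+ K) :
    ∃ h : ℕ → ℕ → MvPolynomial ℕ K,
      (∀ k l, k < N → l < N → (X k - X l) * h k l =
        X k * X l * (pderiv k (finEval K N F) - pderiv l (finEval K N F))) ∧
      finEval K N (laplaceBeltrami β F) =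
        ∑ i ∈ Finset.range N, euler i (euler i (finEval K N F)) +
          C β * (2 * ∑ l ∈ Finset.range N, ∑ k ∈ Finset.range l, h k l -
            ∑ i ∈ Finset.range N, euler i (finEval K N F)) := by
  induction F using MvPolynomial.induction_on with
  | C c =>
    refine ⟨0, by simp [finEval], ?_⟩
    rw [← mul_one (C c), ← smul_eq_C_mul, map_smul, laplaceBeltrami_one]
    simp [finEval, euler]
  | add F G hF hG =>
    obtain ⟨h, h1, h2⟩ := hF
    obtain ⟨h', h1', h2'⟩ := hG
    refine ⟨h + h', fun k l hk hl => ?_, ?_⟩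
    · rw [Pi.add_apply, Pi.add_apply, mul_add, h1 k l hk hl, h1' k l hk hl]
      simp only [map_add]; ring
    · rw [map_add, map_add, h2, h2', map_add]
      simp only [euler_add, Finset.sum_add_distrib, Pi.add_apply]; ring
  | mul_X F n hF =>
    obtain ⟨h, h1, h2⟩ := hF
    -- By the product rule ∂_k − ∂_l of p_n f has the extra term n f (x_k^{n-1} − x_l^{n-1}), whose
    -- quotient is given by `sub_mul_posHomog`.
    refine ⟨fun k l => finPsum K N n * h k l +
      ((n : ℕ) : MvPolynomial ℕ K) * finEval K N F * posHomog n (X k) (X l),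
      fun k l hk hl => ?_, ?_⟩
    · rw [mul_add, mul_left_comm, h1 k l hk hl, mul_left_comm (X k - X l), sub_mul_posHomog, map_mul,
        finEval_X, pderiv_mul, pderiv_mul, pderiv_finPsum hk, pderiv_finPsum hl]
      ring
    · rw [mul_comm F, laplaceBeltrami_X_mul]
      simp only [map_add, map_smul, map_mul, finEval_X, finEval_shiftDer, finEval_sum_pairs, h2,
        Finset.sum_add_distrib, ← Finset.mul_sum]
      have e1 : ∑ i ∈ Finset.range N, euler i (finPsum K N n * finEval K N F) =
          finPsum K N n * ∑ i ∈ Finset.range N, euler i (finEval K N F) +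
            ((n : ℕ) : MvPolynomial ℕ K) * finPsum K N n * finEval K N F := by
        rw [Finset.sum_congr rfl fun i hi => by
          rw [euler_mul, euler_finPsum (Finset.mem_range.1 hi)]]
        rw [Finset.sum_add_distrib, ← Finset.mul_sum, ← Finset.sum_mul, ← Finset.mul_sum, finPsum]
      have e2 : ∑ i ∈ Finset.range N, euler i (euler i (finPsum K N n * finEval K N F)) =
          finPsum K N n * ∑ i ∈ Finset.range N, euler i (euler i (finEval K N F)) +
            ((n : ℕ) : MvPolynomial ℕ K) ^ 2 * finPsum K N n * finEval K N F +
            2 * ((n : ℕ) : MvPolynomial ℕ K) *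
              ∑ i ∈ Finset.range N, X i ^ (n : ℕ) * euler i (finEval K N F) := by
        have (i : ℕ) (hi : i ∈ Finset.range N) :
            euler i (euler i (finPsum K N n * finEval K N F)) =
              finPsum K N n * euler i (euler i (finEval K N F)) +
              ((n : ℕ) : MvPolynomial ℕ K) ^ 2 * (X i ^ (n : ℕ) * finEval K N F) +
              2 * ((n : ℕ) : MvPolynomial ℕ K) * (X i ^ (n : ℕ) * euler i (finEval K N F)) := by
          have hc : euler i ((n : ℕ) : MvPolynomial ℕ K) = 0 := by
            rw [euler, Derivation.map_natCast, mul_zero]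
          rw [euler_mul, euler_finPsum (Finset.mem_range.1 hi), euler_add, euler_mul, euler_mul,
            euler_mul, euler_finPsum (Finset.mem_range.1 hi), euler_X_pow, hc]
          ring
        rw [Finset.sum_congr rfl this, Finset.sum_add_distrib, Finset.sum_add_distrib,
          ← Finset.mul_sum, ← Finset.mul_sum, ← Finset.mul_sum, ← Finset.sum_mul]
        rw [finPsum]; ring
      -- The diagonal of `finEval_sum_pairs` gives β n (n−1) p_n; added to (1−β) n² p_n it leaves n²
      -- p_n − β n p_n, which are the terms from the squared and the simple Euler operators.
      rw [e1, e2]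
      simp only [smul_eq_C_mul, map_mul, map_sub, map_one, map_pow, map_ofNat, map_natCast]
      ring

/-- The coefficients of the quotient of `x_k x_l (∂_k f - ∂_l f)` by `x_k - x_l`. -/
theorem coeff_quotient {k l : ℕ} (hkl : k ≠ l) {f h : MvPolynomial ℕ K}
    (hh : (X k - X l) * h = X k * X l * (pderiv k f - pderiv l f)) (m : ℕ) (e : ℕ →₀ ℕ)
    (he : e l = 0) (j : ℕ) :
    coeff (e + Finsupp.single k j + Finsupp.single l m) h =
      -(m : K) * coeff (e + Finsupp.single k j + Finsupp.single l m) f +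
      ∑ r ∈ Finset.range m, (((e k + j : ℕ) : K) - m + 2 * (r + 1)) *
        coeff (e + Finsupp.single k (j + (r + 1)) + Finsupp.single l (m - (r + 1))) f := by
  -- In this form, comparing coefficients trades one unit of the exponent of x_l for one of x_k,
  -- which permits induction on the exponent m of x_l.
  have key : X k * h - X l * h = X l * euler k f - X k * euler l f := by
    simp only [euler]; linear_combination hh
  induction m generalizing j with
  | zero =>
    have h1 := congrArg (coeff (Finsupp.single k 1 + (e + Finsupp.single k j))) key
    have h0 : (Finsupp.single k 1 + (e + Finsupp.single k j) : ℕ →₀ ℕ) l = 0 := by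
      simp [he, hkl.symm]
    rw [coeff_sub, coeff_sub, coeff_X_mul, coeff_X_mul, coeff_X_mul', coeff_X_mul',
      if_neg (by simpa using h0), if_neg (by simpa using h0), coeff_euler] at h1
    have h2 : (e + Finsupp.single k j) l = 0 := by simp [he, hkl.symm]
    rw [h2] at h1
    simpa using h1
  | succ m ih =>
    -- With h(j, m) and f(j, m) for the coefficients, this reads h(j, m+1) = h(j+1, m) + (e_k + j +
    -- 1) f(j+1, m) − (m+1) f(j, m+1). The term −m f(j+1, m) inside h(j+1, m) completes the new r =
    -- 0 summand.
    have h1 := congrArg (coeff (Finsupp.single k 1 +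
      (e + Finsupp.single k j + Finsupp.single l (m + 1)))) key
    have hs : Finsupp.single k 1 + (e + Finsupp.single k j + Finsupp.single l (m + 1)) =
        Finsupp.single l 1 + (e + Finsupp.single k (j + 1) + Finsupp.single l m) := by
      rw [Finsupp.single_add, Finsupp.single_add]; abel
    rw [coeff_sub, coeff_sub, coeff_X_mul, coeff_X_mul, hs, coeff_X_mul, coeff_X_mul, coeff_euler,
      coeff_euler, ih (j + 1)] at h1
    have h2 : (e + Finsupp.single k (j + 1) + Finsupp.single l m) k = e k + (j + 1) := by
      simp [hkl]
    have h3 : (e + Finsupp.single k j + Finsupp.single l (m + 1)) l = m + 1 := by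
      simp [he, hkl.symm]
    rw [h2, h3] at h1
    have h4 : ∑ r ∈ Finset.range m, (((e k + (j + 1) : ℕ) : K) - m + 2 * (r + 1)) *
        coeff (e + Finsupp.single k (j + 1 + (r + 1)) + Finsupp.single l (m - (r + 1))) f =
      ∑ r ∈ Finset.range m, (((e k + j : ℕ) : K) - (m + 1 : ℕ) + 2 * ((r + 1 : ℕ) + 1)) *
        coeff (e + Finsupp.single k (j + (r + 1 + 1)) +
          Finsupp.single l (m + 1 - (r + 1 + 1))) f := by
      refine Finset.sum_congr rfl fun r _ => ?_
      rw [Nat.add_sub_add_right, show j + 1 + (r + 1) = j + (r + 1 + 1) by ring]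
      push_cast
      ring
    rw [Finset.sum_range_succ', ← h4, Nat.add_sub_add_right, zero_add, Nat.sub_zero]
    push_cast at h1 ⊢
    linear_combination h1

end Finite

/-! ### The action on coefficients. -/

section Coefficients

/-- The exponent `e` with `r` units moved from the variable `l` to the variable `k`. -/
noncomputable def raise (e : ℕ →₀ ℕ) (k l r : ℕ) : ℕ →₀ ℕ :=
  e.erase l + Finsupp.single k r + Finsupp.single l (e l - r)

/-- The coefficient at `x ^ e` of the image under the Laplace–Beltrami operator, in the variables
`x_0, …, x_{N-1}`, of the function with coefficients `c`. -/
noncomputable def lbCoeff {R : Type*} [CommRing R] (β : R) (N : ℕ) (c : (ℕ →₀ ℕ) → R)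
    (e : ℕ →₀ ℕ) : R :=
  ∑ i ∈ Finset.range N, (e i : R) ^ 2 * c e +
    β * (2 * ∑ l ∈ Finset.range N, ∑ k ∈ Finset.range l, (-(e l : R) * c e +
        ∑ r ∈ Finset.range (e l), ((e k : R) - e l + 2 * (r + 1)) * c (raise e k l (r + 1))) -
      ∑ i ∈ Finset.range N, (e i : R) * c e)

/-- The formula uses only ring operations and integers; this is what lets the eigenvalue equation be
specialized. -/
theorem map_lbCoeff {R S : Type*} [CommRing R] [CommRing S] (φ : R →+* S) (β : R) (N : ℕ)
    (c : (ℕ →₀ ℕ) → R) (e : ℕ →₀ ℕ) :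
    φ (lbCoeff β N c e) = lbCoeff (φ β) N (fun e => φ (c e)) e := by
  simp only [lbCoeff, map_add, map_mul, map_sum, map_sub, map_neg, map_pow, map_natCast,
    map_ofNat, map_one]

variable {K : Type*} [Field K] [CharZero K]

/-- Setting the variables beyond the first N to zero does not touch monomials in the first N
variables. -/
theorem coeff_finEval {N : ℕ} {e : ℕ →₀ ℕ} (he : e.support ⊆ Finset.range N)
    (F : MvPolynomial ℕ+ K) :
    MvPolynomial.coeff e (finEval K N F) =
      MvPowerSeries.coeff e (psumEquiv K F : MvPowerSeries ℕ K) := by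
  classical
  induction F using MvPolynomial.induction_on generalizing e with
  | C c =>
    rw [finEval, psumEquiv_apply, MvPolynomial.aeval_C, MvPolynomial.aeval_C,
      MvPolynomial.algebraMap_eq, Subalgebra.coe_algebraMap, ← MvPowerSeries.c_eq_algebraMap,
      MvPolynomial.coeff_C, MvPowerSeries.coeff_C]
    simp only [eq_comm]
  | add F G hF hG =>
    simp only [map_add, MvPolynomial.coeff_add, Subalgebra.coe_add, hF he, hG he]
  | mul_X F n hF =>
    rw [map_mul, map_mul, finEval_X, Subalgebra.coe_mul, MvPolynomial.coeff_mul,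
      MvPowerSeries.coeff_mul]
    refine Finset.sum_congr rfl fun x hx => ?_
    rw [Finset.HasAntidiagonal.mem_antidiagonal] at hx
    subst hx
    have h1 : x.1.support ⊆ Finset.range N := fun i hi => he (by
      simp only [Finsupp.mem_support_iff, Finsupp.add_apply] at hi ⊢; omega)
    have h2 : x.2.support ⊆ Finset.range N := fun i hi => he (by
      simp only [Finsupp.mem_support_iff, Finsupp.add_apply] at hi ⊢; omega)
    rw [hF h1]
    congr 1
    have hX : psumEquiv K (MvPolynomial.X n) = psum K n := by
      rw [psumEquiv_apply, MvPolynomial.aeval_X]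
    rw [hX, psum, coeff_psumSeries, finPsum, MvPolynomial.coeff_sum]
    simp only [MvPolynomial.X_pow_eq_monomial, MvPolynomial.coeff_monomial]
    split_ifs with h
    · obtain ⟨i, hi⟩ := h
      have hiN : i ∈ Finset.range N := h2 (by rw [hi]; simp)
      rw [hi, Finset.sum_eq_single i]
      · simp
      · intro j _ hj
        rw [if_neg]
        intro h
        exact hj ((Finsupp.single_left_inj n.ne_zero).1 h)
      · exact fun h => absurd hiN h
    · exact Finset.sum_eq_zero fun i _ => if_neg fun hi => h ⟨i, hi.symm⟩

theorem raise_support {N k l : ℕ} (hk : k < N) (hl : l < N) {e : ℕ →₀ ℕ}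
    (he : e.support ⊆ Finset.range N) (r : ℕ) : (raise e k l r).support ⊆ Finset.range N := by
  classical
  intro i hi
  by_contra h
  have h0 : e i = 0 := by
    by_contra h0
    exact h (he (Finsupp.mem_support_iff.2 h0))
  rw [Finset.mem_range] at h
  rw [Finsupp.mem_support_iff] at hi
  apply hi
  have hik : i ≠ k := by omega
  have hil : i ≠ l := by omega
  simp [raise, hik, hil, h0, Finsupp.erase_ne]

theorem coeff_lamOp (β : K) (f : Lam K) {N : ℕ} {e : ℕ →₀ ℕ} (he : e.support ⊆ Finset.range N) :
    MvPowerSeries.coeff e (lamOp β f : MvPowerSeries ℕ K) =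
      lbCoeff β N (fun e => MvPowerSeries.coeff e (f : MvPowerSeries ℕ K)) e := by
  obtain ⟨F, rfl⟩ := (psumEquiv K).surjective f
  obtain ⟨h, h1, h2⟩ := exists_finEval_laplaceBeltrami β N F
  have hq (k l : ℕ) (hl : l ∈ Finset.range N) (hk : k ∈ Finset.range l) :
      MvPolynomial.coeff e (h k l) = -(e l : K) * MvPolynomial.coeff e (finEval K N F) +
        ∑ r ∈ Finset.range (e l), ((e k : K) - e l + 2 * (r + 1)) *
          MvPolynomial.coeff (raise e k l (r + 1)) (finEval K N F) := by
    rw [Finset.mem_range] at hl hk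
    have hne : k ≠ l := by omega
    -- Here e is written as its part away from l plus e l units at l, with no extra units at k.
    have h3 := coeff_quotient hne (h1 k l (by omega) hl) (e l) (e.erase l) (by simp) 0
    simpa [raise, Finsupp.erase_add_single, Finsupp.erase_ne hne] using h3
  rw [lamOp_psumEquiv, ← coeff_finEval he, h2]
  simp only [MvPolynomial.coeff_add, MvPolynomial.coeff_C_mul, MvPolynomial.coeff_sub,
    MvPolynomial.coeff_sum, coeff_euler, lbCoeff, ← coeff_finEval he]
  rw [← map_ofNat (MvPolynomial.C : K →+* MvPolynomial ℕ K) 2, MvPolynomial.coeff_C_mul,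
    MvPolynomial.coeff_sum]
  simp only [MvPolynomial.coeff_sum]
  congr 1
  · exact Finset.sum_congr rfl fun i _ => by ring
  · congr 3
    refine Finset.sum_congr rfl fun l hl => Finset.sum_congr rfl fun k hk => ?_
    rw [hq k l hl hk]
    congr 1
    refine Finset.sum_congr rfl fun r _ => ?_
    rw [Finset.mem_range] at hl hk
    rw [coeff_finEval (raise_support (by omega) hl he _)]

end Coefficients

/-! ### Dominance order and the monomial basis. -/

section Dominance

/-- The exponent `(μ_1, μ_2, …)`. -/
noncomputable def partExp (μ : YoungDiagram) : ℕ →₀ ℕ :=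
  Finsupp.onFinset (Finset.range (μ.colLen 0)) μ.rowLen fun i hi => by
    rw [Finset.mem_range, ← YoungDiagram.mem_iff_lt_colLen, YoungDiagram.mem_iff_lt_rowLen]
    exact Nat.pos_of_ne_zero hi

theorem partExp_apply (μ : YoungDiagram) (i : ℕ) : partExp μ i = μ.rowLen i := rfl

theorem support_partExp (μ : YoungDiagram) : (partExp μ).support = Finset.range (μ.colLen 0) := by
  ext i
  rw [Finsupp.mem_support_iff, partExp_apply, Finset.mem_range, ← YoungDiagram.mem_iff_lt_colLen,
    YoungDiagram.mem_iff_lt_rowLen, Nat.pos_iff_ne_zero]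

theorem expType_partExp (μ : YoungDiagram) : expType (partExp μ) = (μ.rowLens : Multiset ℕ) := by
  rw [expType, support_partExp]
  rfl

theorem degree_partExp (μ : YoungDiagram) : (partExp μ).degree = μ.card := by
  have h : μ.cells = ((Finset.range (μ.colLen 0)).sigma fun i => Finset.range (μ.rowLen i)).map
      (Equiv.sigmaEquivProd ℕ ℕ).toEmbedding := by
    ext ⟨i, j⟩
    simp only [YoungDiagram.mem_cells, Finset.mem_map_equiv, Finset.mem_sigma, Finset.mem_range,
      Equiv.sigmaEquivProd_symm_apply, ← YoungDiagram.mem_iff_lt_rowLen,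
      ← YoungDiagram.mem_iff_lt_colLen]
    exact ⟨fun h => ⟨μ.up_left_mem le_rfl (Nat.zero_le _) h, h⟩, And.right⟩
  rw [YoungDiagram.card, h, Finset.card_map, Finset.card_sigma, Finsupp.degree_apply,
    support_partExp]
  simp [partExp_apply]

/-- The indicator of the permutation orbit of e is itself a symmetric function, so
`coeff_eq_of_expType_eq` forces it to be 1 at e' as well. -/
theorem exists_perm_of_expType_eq {e e' : ℕ →₀ ℕ} (h : expType e = expType e') :
    ∃ σ : Equiv.Perm ℕ, e' = e.embDomain σ.toEmbedding := by
  classical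
  let f : MvPowerSeries ℕ ℚ :=
    ofCoeff fun x => if ∃ σ : Equiv.Perm ℕ, x = e.embDomain σ.toEmbedding then 1 else 0
  have hemb (σ τ : Equiv.Perm ℕ) (x : ℕ →₀ ℕ) :
      (x.embDomain σ.toEmbedding).embDomain τ.toEmbedding =
        x.embDomain (σ.trans τ).toEmbedding := by
    ext i
    obtain ⟨j, rfl⟩ := (σ.trans τ).surjective i
    have h1 := Finsupp.embDomain_apply_self τ.toEmbedding (x.embDomain σ.toEmbedding) (σ j)
    have h2 := Finsupp.embDomain_apply_self σ.toEmbedding x j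
    have h3 := Finsupp.embDomain_apply_self (σ.trans τ).toEmbedding x j
    simp only [Equiv.coe_toEmbedding, Equiv.trans_apply] at h1 h2 h3 ⊢
    rw [h1, h2, h3]
  have hf : f ∈ Lam ℚ := by
    refine mem_Lam_iff.2 ⟨fun σ x => ?_, e.degree, fun x hx => ?_⟩
    · rw [coeff_ofCoeff, coeff_ofCoeff]
      congr 1
      refine propext ⟨?_, ?_⟩
      · rintro ⟨τ, hτ⟩
        refine ⟨τ.trans σ.symm, Finsupp.embDomain_injective σ.toEmbedding ?_⟩
        rw [hτ, hemb, Equiv.trans_assoc, Equiv.symm_trans_self, Equiv.trans_refl]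
      · rintro ⟨τ, rfl⟩
        exact ⟨_, hemb τ σ e⟩
    · rw [coeff_ofCoeff, if_neg]
      rintro ⟨σ, rfl⟩
      rw [← sum_expType (e.embDomain _), expType_embDomain, sum_expType] at hx
      exact lt_irrefl _ hx
  have h1 := coeff_eq_of_expType_eq hf h
  have hrefl : e = e.embDomain (Equiv.refl ℕ).toEmbedding := by
    ext i
    exact (Finsupp.embDomain_apply_self (Equiv.refl ℕ).toEmbedding e i).symm
  rw [coeff_ofCoeff, coeff_ofCoeff, if_pos ⟨Equiv.refl ℕ, hrefl⟩] at h1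
  by_contra hc
  rw [if_neg hc] at h1
  exact one_ne_zero h1
-- The i-th smallest element of s, counted from 0, is at least i.
theorem sum_le_sum_range_of_antitone {f : ℕ → ℕ} (hf : Antitone f) (s : Finset ℕ) :
    ∑ i ∈ s, f i ≤ ∑ i ∈ Finset.range s.card, f i := by
  have hmono : ∀ i : Fin s.card, (i : ℕ) ≤ s.orderEmbOfFin rfl i := by
    rintro ⟨i, hi⟩
    induction i with
    | zero => exact Nat.zero_le _
    | succ i ih =>
      have h1 := ih (by omega)
      have h2 : s.orderEmbOfFin rfl ⟨i, by omega⟩ < s.orderEmbOfFin rfl ⟨i + 1, hi⟩ :=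
        (s.orderEmbOfFin rfl).strictMono (by simp [Fin.lt_def])
      exact Nat.lt_of_le_of_lt h1 h2
  calc ∑ i ∈ s, f i = ∑ i : Fin s.card, f (s.orderEmbOfFin rfl i) := by
        conv_lhs => rw [← Finset.map_orderEmbOfFin_univ s rfl, Finset.sum_map]
        rfl
    _ ≤ ∑ i : Fin s.card, f i := Finset.sum_le_sum fun i _ => hf (hmono i)
    _ = _ := Fin.sum_univ_eq_sum_range f _

theorem sum_range_le_of_expType_eq {e : ℕ →₀ ℕ} {lam : YoungDiagram}
    (h : expType e = (lam.rowLens : Multiset ℕ)) (k : ℕ) :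
    ∑ i ∈ Finset.range k, e i ≤ ∑ i ∈ Finset.range k, lam.rowLen i := by
  rw [← expType_partExp] at h
  obtain ⟨σ, hσ⟩ := exists_perm_of_expType_eq h
  have h1 (i : ℕ) : e i = lam.rowLen (σ i) := by
    rw [← partExp_apply, hσ]
    exact (Finsupp.embDomain_apply_self σ.toEmbedding e i).symm
  have h2 := sum_le_sum_range_of_antitone (fun i j => lam.rowLen_anti i j)
    ((Finset.range k).map σ.toEmbedding)
  rw [Finset.sum_map, Finset.card_map, Finset.card_range] at h2
  simp only [h1]
  exact h2

theorem DomLE.antisymm {μ ν : YoungDiagram} (h : DomLE μ ν) (h' : DomLE ν μ) : μ = ν := by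
  have hs (k : ℕ) := le_antisymm (h.2 k) (h'.2 k)
  have hr (i : ℕ) : μ.rowLen i = ν.rowLen i := by
    have h1 := hs (i + 1)
    rw [Finset.sum_range_succ, Finset.sum_range_succ, hs i] at h1
    omega
  ext ⟨i, j⟩
  rw [YoungDiagram.mem_cells, YoungDiagram.mem_cells, YoungDiagram.mem_iff_lt_rowLen,
    YoungDiagram.mem_iff_lt_rowLen, hr]

theorem DomLE.refl (μ : YoungDiagram) : DomLE μ μ := ⟨rfl, fun _ => le_rfl⟩

theorem DomLE.trans {μ ν lam : YoungDiagram} (h : DomLE μ ν) (h' : DomLE ν lam) : DomLE μ lam :=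
  ⟨h.1.trans h'.1, fun k => (h.2 k).trans (h'.2 k)⟩

theorem eq_of_rowLens_eq {μ ν : YoungDiagram}
    (h : (μ.rowLens : Multiset ℕ) = (ν.rowLens : Multiset ℕ)) : μ = ν := by
  have key {μ ν : YoungDiagram} (h : (μ.rowLens : Multiset ℕ) = (ν.rowLens : Multiset ℕ)) :
      DomLE μ ν := by
    refine ⟨?_, fun k => sum_range_le_of_expType_eq ((expType_partExp μ).trans h) k⟩
    rw [← degree_partExp, ← degree_partExp, ← sum_expType, ← sum_expType, expType_partExp,
      expType_partExp, h]
  exact (key h).antisymm (key h.symm)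

theorem exists_rowLens_eq_expType (e : ℕ →₀ ℕ) :
    ∃ μ : YoungDiagram, expType e = (μ.rowLens : Multiset ℕ) := by
  have hs : ((expType e).sort (· ≥ ·)).SortedGE := (Multiset.pairwise_sort _ _).sortedGE
  refine ⟨YoungDiagram.ofRowLens _ hs, ?_⟩
  rw [YoungDiagram.rowLens_ofRowLens_eq_self fun x hx => expType_pos ((Multiset.mem_sort _).1 hx),
    Multiset.sort_eq]

/-- The removed units are added on the left to avoid truncated subtraction. -/
theorem raise_apply_add {e : ℕ →₀ ℕ} {k l r : ℕ} (hkl : k ≠ l) (hr : r ≤ e l) (i : ℕ) :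
    raise e k l r i + (if i = l then r else 0) = e i + if i = k then r else 0 := by
  classical
  by_cases h : i = l
  · subst h
    have := hkl.symm
    simp [raise, this, hr]
  · by_cases h' : i = k
    · subst h'
      simp [raise, h, Finsupp.erase_ne]
    · simp [raise, h, h', Finsupp.erase_ne]

theorem degree_raise {e : ℕ →₀ ℕ} {k l r : ℕ} (hr : r ≤ e l) :
    (raise e k l r).degree = e.degree := by
  conv_rhs => rw [← Finsupp.erase_add_single l e]
  simp only [raise, map_add, Finsupp.degree_single]
  omega

theorem sum_range_raise {e : ℕ →₀ ℕ} {k l r : ℕ} (hkl : k ≠ l) (hr : r ≤ e l) (m : ℕ) :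
    ∑ i ∈ Finset.range m, raise e k l r i + (if l < m then r else 0) =
      ∑ i ∈ Finset.range m, e i + if k < m then r else 0 := by
  have h := Finset.sum_congr rfl fun i (_ : i ∈ Finset.range m) => raise_apply_add hkl hr i
  simpa [Finset.sum_add_distrib, Finset.sum_ite_eq'] using h

/-- Moving r units from row l up to row k adds r to the partial sums of length m with k < m ≤ l and
keeps the others; sorting the result can only increase partial sums. The sum of length k + 1 grows
strictly, so the partitions differ. -/
theorem domLE_of_expType_raise {μ lam : YoungDiagram} {k l r : ℕ} (hkl : k < l) (hr0 : 0 < r)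
    (hr : r ≤ μ.rowLen l)
    (h : expType (raise (partExp μ) k l r) = (lam.rowLens : Multiset ℕ)) :
    DomLE μ lam ∧ μ ≠ lam := by
  have hsum := sum_range_raise (e := partExp μ) hkl.ne hr
  have hle := sum_range_le_of_expType_eq h
  refine ⟨⟨?_, fun m => ?_⟩, ?_⟩
  · rw [← degree_partExp, ← degree_partExp lam, ← sum_expType (partExp lam), expType_partExp, ← h,
      sum_expType, degree_raise hr]
  · have h1 := hsum m
    have h2 := hle m
    simp only [partExp_apply] at h1
    split_ifs at h1 <;> omega
  · rintro rfl
    have h1 := hsum (k + 1)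
    have h2 := hle (k + 1)
    simp only [partExp_apply] at h1
    rw [if_neg (by omega), if_pos (by omega)] at h1
    omega

theorem finite_card_le (D : ℕ) : {μ : YoungDiagram | μ.card ≤ D}.Finite := by
  refine Set.Finite.of_injOn (f := YoungDiagram.cells)
    (t := ((Finset.range D ×ˢ Finset.range D).powerset : Finset (Finset (ℕ × ℕ)))) ?_
    (fun μ _ ν _ h => YoungDiagram.ext h) (Finset.finite_toSet _)
  intro μ hμ
  simp only [Finset.mem_coe, Finset.mem_powerset]
  rintro ⟨i, j⟩ hij
  rw [YoungDiagram.mem_cells] at hij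
  have hr : μ.rowLen i ≤ μ.card := by
    rw [YoungDiagram.rowLen_eq_card]
    exact Finset.card_le_card (Finset.filter_subset _ _)
  have hc : μ.colLen j ≤ μ.card := by
    rw [YoungDiagram.colLen_eq_card]
    exact Finset.card_le_card (Finset.filter_subset _ _)
  have h1 := YoungDiagram.mem_iff_lt_rowLen.1 hij
  have h2 := YoungDiagram.mem_iff_lt_colLen.1 hij
  have h3 : μ.card ≤ D := hμ
  rw [Finset.mem_product, Finset.mem_range, Finset.mem_range]
  exact ⟨by omega, by omega⟩

variable {K : Type*} [CommRing K]

open Classical in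
theorem coeff_msymm (μ : YoungDiagram) (e : ℕ →₀ ℕ) :
    MvPowerSeries.coeff e (msymm K μ : MvPowerSeries ℕ K) =
      if expType e = (μ.rowLens : Multiset ℕ) then 1 else 0 := by
  rw [msymm, coeff_ofCoeff]

/-- A symmetric function is the sum of its coefficients at the exponents `partExp μ` times m_μ;
bounded degree makes this sum finite. -/
theorem mem_span_msymm {f : Lam K} {S : Set YoungDiagram}
    (h : ∀ μ, MvPowerSeries.coeff (partExp μ) (f : MvPowerSeries ℕ K) ≠ 0 → μ ∈ S) :
    f ∈ Submodule.span K (msymm K '' S) := by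
  classical
  obtain ⟨D, hD⟩ := (mem_Lam_iff.1 f.2).2
  have hf : f = ∑ μ ∈ (finite_card_le D).toFinset,
      MvPowerSeries.coeff (partExp μ) (f : MvPowerSeries ℕ K) • msymm K μ := by
    ext e
    obtain ⟨ν, hν⟩ := exists_rowLens_eq_expType e
    have he : MvPowerSeries.coeff e (f : MvPowerSeries ℕ K) =
        MvPowerSeries.coeff (partExp ν) (f : MvPowerSeries ℕ K) :=
      coeff_eq_of_expType_eq f.2 (by rw [hν, expType_partExp])
    rw [AddSubmonoidClass.coe_finsetSum, map_sum, Finset.sum_eq_single ν]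
    · rw [Subalgebra.coe_smul, MvPowerSeries.coeff_smul, coeff_msymm, if_pos hν, he, mul_one]
    · intro μ _ hμ
      rw [Subalgebra.coe_smul, MvPowerSeries.coeff_smul, coeff_msymm, if_neg, mul_zero]
      rw [hν]
      exact fun h => hμ (eq_of_rowLens_eq h).symm
    · intro hν'
      rw [Subalgebra.coe_smul, MvPowerSeries.coeff_smul, hD (partExp ν), zero_mul]
      rw [degree_partExp]
      simpa using hν'
  rw [hf]
  refine Submodule.sum_mem _ fun μ _ => ?_
  by_cases h0 : MvPowerSeries.coeff (partExp μ) (f : MvPowerSeries ℕ K) = 0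
  · rw [h0, zero_smul]
    exact Submodule.zero_mem _
  · exact Submodule.smul_mem _ _ (Submodule.subset_span ⟨μ, h μ h0, rfl⟩)

end Dominance

/-! ### Triangularity, and Jack functions as eigenvectors. -/

section Eigenvalue

/-- `∑_i (λ_i ^ 2 + β (1 - 2 i) λ_i)`, where the row of index `i` (from `0`) is `λ_{i+1}`. -/
noncomputable def eigenvalue {R : Type*} [CommRing R] (β : R) (lam : YoungDiagram) : R :=
  ∑ i ∈ Finset.range (lam.colLen 0),
    ((lam.rowLen i : R) ^ 2 + β * (1 - 2 * ((i : R) + 1)) * (lam.rowLen i : R))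

theorem map_eigenvalue {R S : Type*} [CommRing R] [CommRing S] (φ : R →+* S) (β : R)
    (lam : YoungDiagram) : φ (eigenvalue β lam) = eigenvalue (φ β) lam := by
  simp only [eigenvalue, map_add, map_mul, map_sum, map_sub, map_pow, map_natCast, map_ofNat,
    map_one]

/-- Only the diagonal survives. Each k < l contributes −μ_l, so row l (from 0) gets μ_l² + β(−2l μ_l
− μ_l), and −2l − 1 = 1 − 2(l+1). -/
theorem lbCoeff_eq_eigenvalue_mul {R : Type*} [CommRing R] (β : R) {c : (ℕ →₀ ℕ) → R}
    {μ : YoungDiagram} (h : ∀ l k r, k < l → r < μ.rowLen l → c (raise (partExp μ) k l (r + 1)) = 0) :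
    lbCoeff β (μ.colLen 0) c (partExp μ) = eigenvalue β μ * c (partExp μ) := by
  have h1 : ∑ l ∈ Finset.range (μ.colLen 0), ∑ k ∈ Finset.range l,
      (-(partExp μ l : R) * c (partExp μ) + ∑ r ∈ Finset.range (partExp μ l),
        ((partExp μ k : R) - partExp μ l + 2 * (r + 1)) * c (raise (partExp μ) k l (r + 1))) =
      ∑ l ∈ Finset.range (μ.colLen 0), (l : R) * (-(partExp μ l : R) * c (partExp μ)) := by
    refine Finset.sum_congr rfl fun l _ => ?_
    rw [Finset.sum_congr rfl fun k hk => by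
      rw [Finset.sum_eq_zero fun r hr => by
        rw [h l k r (Finset.mem_range.1 hk) (Finset.mem_range.1 hr), mul_zero], add_zero]]
    rw [Finset.sum_const, Finset.card_range, nsmul_eq_mul]
  rw [lbCoeff, h1, eigenvalue, Finset.sum_mul, Finset.mul_sum, ← Finset.sum_sub_distrib,
    Finset.mul_sum, ← Finset.sum_add_distrib]
  refine Finset.sum_congr rfl fun i _ => ?_
  rw [partExp_apply]
  ring

variable {K : Type*} [Field K] [CharZero K]

/-- If μ is not strictly below lam, no exponent raised from μ has type lam, so the coefficient at μ
is purely diagonal and cancels. -/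
theorem lamOp_msymm_sub_mem (β : K) (lam : YoungDiagram) :
    lamOp β (msymm K lam) - eigenvalue β lam • msymm K lam ∈
      Submodule.span K (msymm K '' {μ | DomLE μ lam ∧ μ ≠ lam}) := by
  classical
  refine mem_span_msymm fun μ hμ => ?_
  by_contra hdom
  refine hμ ?_
  rw [AddSubgroupClass.coe_sub, map_sub, coeff_lamOp β _ (support_partExp μ).subset,
    lbCoeff_eq_eigenvalue_mul, Subalgebra.coe_smul, MvPowerSeries.coeff_smul]
  · by_cases h : μ = lam
    · rw [h, sub_self]
    · rw [coeff_msymm, expType_partExp, if_neg fun h' => h (eq_of_rowLens_eq h'), mul_zero,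
        mul_zero, sub_zero]
  · intro l k r hkl hr
    rw [coeff_msymm, if_neg]
    exact fun h => hdom (domLE_of_expType_raise hkl r.succ_pos hr h)

theorem lamOp_mem_span {β : K} {S : Set YoungDiagram}
    (hS : ∀ μ ∈ S, ∀ ν, DomLE ν μ → ν ∈ S) {f : Lam K}
    (hf : f ∈ Submodule.span K (msymm K '' S)) :
    lamOp β f ∈ Submodule.span K (msymm K '' S) := by
  induction hf using Submodule.span_induction with
  | mem f hf =>
    obtain ⟨μ, hμ, rfl⟩ := hf
    rw [← sub_add_cancel (lamOp β (msymm K μ)) (eigenvalue β μ • msymm K μ)]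
    refine Submodule.add_mem _ (Submodule.span_mono (Set.image_mono ?_)
      (lamOp_msymm_sub_mem β μ))
      (Submodule.smul_mem _ _ (Submodule.subset_span ⟨μ, hμ, rfl⟩))
    exact fun ν hν => hS μ hμ ν hν.1
  | zero => rw [map_zero]; exact Submodule.zero_mem _
  | add f g _ _ hf hg => rw [map_add]; exact Submodule.add_mem _ hf hg
  | smul c f _ hf => rw [map_smul]; exact Submodule.smul_mem _ _ hf

theorem span_msymm_eq_top {K : Type*} [Field K] :
    Submodule.span K (Set.range (msymm K)) = ⊤ := by
  refine (Submodule.eq_top_iff').2 fun f => ?_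
  rw [← Set.image_univ]
  exact mem_span_msymm fun _ _ => Set.mem_univ _

theorem DomLE.lt_of_le_of_ne {μ ν lam : YoungDiagram} (h : DomLE μ ν) (h' : DomLE ν lam)
    (hne : ν ≠ lam) : DomLE μ lam ∧ μ ≠ lam :=
  ⟨h.trans h', fun he => hne (h'.antisymm (he ▸ h))⟩

theorem finite_domLE (lam : YoungDiagram) : {μ | DomLE μ lam}.Finite :=
  (finite_card_le lam.card).subset fun _ h => h.1.le

namespace IsJackFamily

variable {P : YoungDiagram → Lam (RatFunc ℚ)}

/-- Inverts the unitriangular change of basis, by induction on the number of partitions dominated by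
lam. -/
theorem span_msymm_le (hP : IsJackFamily P) (lam : YoungDiagram) :
    Submodule.span (RatFunc ℚ) (msymm (RatFunc ℚ) '' {μ | DomLE μ lam ∧ μ ≠ lam}) ≤
      Submodule.span (RatFunc ℚ) (P '' {μ | DomLE μ lam ∧ μ ≠ lam}) := by
  induction hn : {μ | DomLE μ lam}.ncard using Nat.strong_induction_on generalizing lam with
  | _ n ih =>
    rw [Submodule.span_le]
    rintro _ ⟨μ, ⟨hμ, hne⟩, rfl⟩
    have hlt : {ν | DomLE ν μ}.ncard < n := by
      rw [← hn]
      refine Set.ncard_lt_ncard ⟨fun ν hν => hν.trans hμ, fun h => ?_⟩ (finite_domLE lam)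
      exact hne (hμ.antisymm (h (DomLE.refl lam)))
    have h1 := ih _ hlt μ rfl (hP.triangular μ)
    have h2 : P μ - (P μ - msymm (RatFunc ℚ) μ) ∈
        Submodule.span (RatFunc ℚ) (P '' {μ | DomLE μ lam ∧ μ ≠ lam}) :=
      Submodule.sub_mem _ (Submodule.subset_span ⟨μ, ⟨hμ, hne⟩, rfl⟩)
        (Submodule.span_mono (Set.image_mono fun ν hν => hν.1.lt_of_le_of_ne hμ hne) h1)
    rwa [sub_sub_cancel] at h2

theorem span_eq_top (hP : IsJackFamily P) :
    Submodule.span (RatFunc ℚ) (Set.range P) = ⊤ := by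
  rw [eq_top_iff, ← span_msymm_eq_top, Submodule.span_le]
  rintro _ ⟨μ, rfl⟩
  rw [SetLike.mem_coe, ← sub_sub_cancel (P μ) (msymm (RatFunc ℚ) μ)]
  exact Submodule.sub_mem _ (Submodule.subset_span ⟨μ, rfl⟩)
    (Submodule.span_mono (Set.image_subset_range _ _) (hP.span_msymm_le μ (hP.triangular μ)))

theorem jackForm_eq_zero (hP : IsJackFamily P) {lam : YoungDiagram} {S : Set YoungDiagram}
    (hS : lam ∉ S) {f : Lam (RatFunc ℚ)} (hf : f ∈ Submodule.span (RatFunc ℚ) (P '' S)) :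
    jackForm (RatFunc.X : RatFunc ℚ) (P lam) f = 0 := by
  induction hf using Submodule.span_induction with
  | mem f hf =>
    obtain ⟨μ, hμ, rfl⟩ := hf
    exact hP.orthogonal _ _ fun h => hS (h ▸ hμ)
  | zero => rw [map_zero]
  | add f g _ _ hf hg => rw [map_add, hf, hg, add_zero]
  | smul c f _ hf => rw [map_smul, hf, smul_zero]

/-- The Jack symmetric functions are eigenvectors of the Laplace–Beltrami operator. -/
theorem lamOp_eq (hP : IsJackFamily P) (lam : YoungDiagram) :
    lamOp (RatFunc.X : RatFunc ℚ)⁻¹ (P lam) =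
      eigenvalue (RatFunc.X : RatFunc ℚ)⁻¹ lam • P lam := by
  set b : RatFunc ℚ := RatFunc.X
  have hb : b ≠ 0 := RatFunc.X_ne_zero
  set V := Submodule.span (RatFunc ℚ) (msymm (RatFunc ℚ) '' {μ | DomLE μ lam ∧ μ ≠ lam})
  have hclosed {lam : YoungDiagram} : ∀ μ ∈ {μ | DomLE μ lam ∧ μ ≠ lam}, ∀ ν, DomLE ν μ →
      ν ∈ {μ | DomLE μ lam ∧ μ ≠ lam} := fun μ hμ ν hν => hν.lt_of_le_of_ne hμ.1 hμ.2
  -- The leading terms m_λ cancel, so the defect of the eigenvalue equation lies strictly below lam.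
  have hw : lamOp b⁻¹ (P lam) - eigenvalue b⁻¹ lam • P lam ∈ V := by
    have h1 := lamOp_msymm_sub_mem b⁻¹ lam
    have h2 := lamOp_mem_span (β := b⁻¹) hclosed (hP.triangular lam)
    have h3 := V.sub_mem (V.add_mem h1 h2)
      (V.smul_mem (eigenvalue b⁻¹ lam) (hP.triangular lam))
    rw [map_sub, smul_sub] at h3
    convert h3 using 1
    abel
  have hwP := hP.span_msymm_le lam hw
  rw [← sub_eq_zero]
  refine eq_zero_of_jackForm_eq_zero hb fun g => ?_
  have hg : g ∈ Submodule.span (RatFunc ℚ) (Set.range P) := by rw [hP.span_eq_top]; trivial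
  induction hg using Submodule.span_induction with
  | mem g hg =>
    obtain ⟨μ, rfl⟩ := hg
    -- For μ strictly below lam the operator is moved onto P μ, whose image stays below lam and so
    -- is orthogonal to P lam. Otherwise P μ is orthogonal to the defect because the latter is a
    -- combination of other Jack functions.
    by_cases hμ : DomLE μ lam ∧ μ ≠ lam
    · rw [map_sub, LinearMap.sub_apply, map_smul, LinearMap.smul_apply,
        hP.orthogonal _ _ hμ.2.symm, smul_zero, sub_zero, jackForm_lamOp (mul_inv_cancel₀ hb)]
      refine hP.jackForm_eq_zero (S := {μ | DomLE μ lam ∧ μ ≠ lam}) (fun h => h.2 rfl)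
        (hP.span_msymm_le lam (lamOp_mem_span hclosed ?_))
      rw [← sub_add_cancel (P μ) (msymm (RatFunc ℚ) μ)]
      exact V.add_mem (Submodule.span_mono (Set.image_mono fun ν hν =>
        hν.1.lt_of_le_of_ne hμ.1 hμ.2) (hP.triangular μ)) (Submodule.subset_span ⟨μ, hμ, rfl⟩)
    · rw [jackForm_comm]
      exact hP.jackForm_eq_zero hμ hwP
  | zero => rw [map_zero]
  | add f g _ _ hf hg => rw [map_add, hf, hg, add_zero]
  | smul c f _ hf => rw [map_smul, hf, smul_zero]

end IsJackFamily

end Eigenvalue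

/-! ### Specialization of the eigenvalue equation at b = β⁻¹. -/

section Specialization

/-- The rational functions that are regular at `b₀`. -/
noncomputable def regularSubring (b₀ : ℂ) : Subring (RatFunc ℚ) where
  carrier := {x | x.denom.eval₂ (algebraMap ℚ ℂ) b₀ ≠ 0}
  mul_mem' {x y} hx hy h := by
    have := Polynomial.eval₂_eq_zero_of_dvd_of_eval₂_eq_zero _ _ (RatFunc.denom_mul_dvd x y) h
    rw [Polynomial.eval₂_mul] at this
    exact (mul_ne_zero hx hy) this
  add_mem' {x y} hx hy h := by
    have := Polynomial.eval₂_eq_zero_of_dvd_of_eval₂_eq_zero _ _ (RatFunc.denom_add_dvd x y) h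
    rw [Polynomial.eval₂_mul] at this
    exact (mul_ne_zero hx hy) this
  one_mem' := by simp
  zero_mem' := by simp
  neg_mem' {x} hx h := by
    have h1 : -x = RatFunc.C (-1) * x := by simp
    rw [h1] at h
    have := Polynomial.eval₂_eq_zero_of_dvd_of_eval₂_eq_zero _ _ (RatFunc.denom_mul_dvd _ x) h
    rw [RatFunc.denom_C, one_mul] at this
    exact hx this

/-- Evaluation at `b₀` of the rational functions regular there. -/
noncomputable def regularEval (b₀ : ℂ) : regularSubring b₀ →+* ℂ where
  toFun x := (x : RatFunc ℚ).eval (algebraMap ℚ ℂ) b₀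
  map_one' := RatFunc.eval_one _ _
  map_zero' := RatFunc.eval_zero _ _
  map_add' x y := RatFunc.eval_add _ _ x.2 y.2
  map_mul' x y := RatFunc.eval_mul _ _ x.2 y.2

theorem lamOp_specialize {β : ℂ} (hβ : β ≠ 0) {f : Lam (RatFunc ℚ)} (hf : RegularAt f β⁻¹)
    {lam : YoungDiagram} (h : lamOp (RatFunc.X : RatFunc ℚ)⁻¹ f =
      eigenvalue (RatFunc.X : RatFunc ℚ)⁻¹ lam • f) :
    lamOp β (specialize f β⁻¹) = eigenvalue β lam • specialize f β⁻¹ := by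
  have hX : (RatFunc.X : RatFunc ℚ) ∈ regularSubring β⁻¹ := by
    change Polynomial.eval₂ _ _ _ ≠ 0
    simp
  -- The only pole of 1/b is at 0, and β⁻¹ ≠ 0.
  have hXi : (RatFunc.X : RatFunc ℚ)⁻¹ ∈ regularSubring β⁻¹ := fun h0 => by
    have := Polynomial.eval₂_eq_zero_of_dvd_of_eval₂_eq_zero _ _
      (RatFunc.denom_inv_dvd (RatFunc.X_ne_zero (K := ℚ))) h0
    rw [RatFunc.num_X, Polynomial.eval₂_X] at this
    exact inv_ne_zero hβ this
  let β' : regularSubring β⁻¹ := ⟨_, hXi⟩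
  let c : (ℕ →₀ ℕ) → regularSubring β⁻¹ :=
    fun e => ⟨MvPowerSeries.coeff e (f : MvPowerSeries ℕ (RatFunc ℚ)), hf e⟩
  have hβ' : regularEval β⁻¹ β' = β := by
    have h1 : β' * ⟨_, hX⟩ = 1 := Subtype.ext (inv_mul_cancel₀ RatFunc.X_ne_zero)
    have h2 := congrArg (regularEval β⁻¹) h1
    have h3 : regularEval β⁻¹ ⟨_, hX⟩ = β⁻¹ := RatFunc.eval_X _ _
    rw [map_mul, map_one, h3] at h2
    exact (mul_inv_eq_one₀ hβ).1 h2
  ext e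
  obtain ⟨N, hN⟩ : ∃ N, e.support ⊆ Finset.range N := Finset.exists_nat_subset_range _
  -- The equation at x^e is an identity inside the ring of functions regular at β⁻¹, so the
  -- evaluation homomorphism applies to it.
  have key : lbCoeff β' N c e = eigenvalue β' lam * c e := by
    refine Subtype.ext ?_
    have h1 := congrArg (fun g : Lam (RatFunc ℚ) =>
      MvPowerSeries.coeff e (g : MvPowerSeries ℕ (RatFunc ℚ))) h
    simp only [coeff_lamOp _ _ hN, Subalgebra.coe_smul, MvPowerSeries.coeff_smul] at h1
    have h2 := map_lbCoeff (regularSubring β⁻¹).subtype β' N c e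
    have h3 := map_eigenvalue (regularSubring β⁻¹).subtype β' lam
    rw [Subring.subtype_apply] at h2 h3
    rw [h2, Subring.coe_mul, h3]
    exact h1
  have h4 := congrArg (regularEval β⁻¹) key
  rw [map_lbCoeff, map_mul, map_eigenvalue, hβ'] at h4
  rw [coeff_lamOp _ _ hN, Subalgebra.coe_smul, MvPowerSeries.coeff_smul]
  exact h4

end Specialization

end SymFn

/-! ### The Fock space operator and its transport by `iota`. -/

namespace Heis

open MvPolynomial

theorem a_X_mul (α : ℂ) (m : ℤ) (k : ℕ+) (v : Fock) :
    a α m (X k * v) = X k * a α m v + if m = k then (k : ℂ) • v else 0 := by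
  classical
  rcases lt_trichotomy m 0 with h | rfl | h
  · obtain ⟨n, rfl⟩ : ∃ n : ℕ+, m = -(n : ℤ) := ⟨toPNat (-m) (by omega), by simp [toPNat]; omega⟩
    have hk : 0 < (k : ℤ) := by exact_mod_cast k.pos
    rw [a_neg, a_neg, if_neg (by omega)]
    ring
  · have hk : 0 < (k : ℤ) := by exact_mod_cast k.pos
    rw [a_zero, a_zero, if_neg (by omega), add_zero, mul_smul_comm]
  · obtain ⟨n, rfl⟩ : ∃ n : ℕ+, m = (n : ℤ) := ⟨toPNat m h, by simp [toPNat]; omega⟩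
    rw [a_pos, a_pos, pderiv_mul, pderiv_X, Pi.single_apply]
    by_cases hn : n = k
    · subst hn
      simp only [if_true, one_mul, smul_add, mul_smul_comm]
      ring
    · have hn' : (n : ℤ) ≠ k := fun h => hn (PNat.coe_injective (by exact_mod_cast h))
      rw [if_neg hn', if_neg (Ne.symm hn), zero_mul, zero_add, add_zero, mul_smul_comm]

theorem normalOrdered_X_mul (α : ℂ) (m j : ℤ) (k : ℕ+) (v : Fock) :
    normalOrdered α m j (X k * v) = X k * normalOrdered α m j v +
      (if m = k then (k : ℂ) • a α j v else 0) + (if j = k then (k : ℂ) • a α m v else 0) := by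
  unfold normalOrdered
  split_ifs <;>
    simp only [Module.End.mul_apply, a_X_mul, map_add, map_smul, if_true, add_zero,
      *, if_false]

/-- This is [L_n, a_{-k}] = k a_{n-k} − (n+1) ρ n δ_{n,k}. The indices m = k and n − m = k each
produce k a_{n-k}, which absorbs the factor 1/2. -/
theorem vir_X_mul (α ρ : ℂ) (n k : ℕ+) (v : Fock) :
    vir α ρ n (X k * v) = X k * vir α ρ n v + (k : ℂ) • a α ((n : ℤ) - k) v -
      if n = k then (((k : ℂ) + 1) * ρ * k) • v else 0 := by
  have hfin := vir_support_finite α n v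
  have hX : (Function.support fun m : ℤ => X k * normalOrdered α m (n - m) v).Finite :=
    hfin.subset fun m hm hm' => hm (by simp only at hm' ⊢; rw [hm', mul_zero])
  have h1 : (Function.support fun m : ℤ =>
      if m = (k : ℤ) then (k : ℂ) • a α (n - m) v else 0).Finite :=
    (Set.finite_singleton (k : ℤ)).subset fun m hm => by
      by_contra h
      exact hm (if_neg h)
  have h2 : (Function.support fun m : ℤ =>
      if (n : ℤ) - m = (k : ℤ) then (k : ℂ) • a α m v else 0).Finite :=
    (Set.finite_singleton ((n : ℤ) - k)).subset fun m hm => by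
      by_contra h
      refine hm (if_neg fun h' => h ?_)
      rw [Set.mem_singleton_iff]
      omega
  have hsum : ∑ᶠ m : ℤ, normalOrdered α m (n - m) (X k * v) =
      X k * ∑ᶠ m : ℤ, normalOrdered α m (n - m) v + (2 * k : ℂ) • a α ((n : ℤ) - k) v := by
    simp only [normalOrdered_X_mul]
    rw [finsum_add_distrib ((hX.union h1).subset (Function.support_add _ _)) h2,
      finsum_add_distrib hX h1, ← mul_finsum' _ _ hfin,
      finsum_eq_single _ (k : ℤ) fun m hm => if_neg hm, if_pos rfl,
      finsum_eq_single _ ((n : ℤ) - k) fun m hm => if_neg fun h => hm (by omega),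
      if_pos (by omega), mul_smul, two_smul, add_assoc]
  rw [vir, vir, hsum, a_X_mul]
  by_cases h : n = k
  · subst h
    simp only [if_true, smul_eq_C_mul, map_mul, map_add, map_ofNat, Int.cast_natCast, map_natCast,
      map_one, mul_add]
    have h3 : (C (1 / 2 : ℂ) : Fock) * 2 = 1 := by
      rw [← map_ofNat (C : ℂ →+* Fock) 2, ← map_mul]; norm_num
    linear_combination (((n : ℕ) : Fock) * a α ((n : ℤ) - n) v) * h3
  · have hn' : (n : ℤ) ≠ k := fun h' => h (PNat.coe_injective (by exact_mod_cast h'))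
    rw [if_neg h, if_neg hn', add_zero, sub_zero]
    simp only [smul_eq_C_mul, map_mul, map_add, map_ofNat, Int.cast_natCast, map_natCast,
      map_one, mul_add]
    have h3 : (C (1 / 2 : ℂ) : Fock) * 2 = 1 := by
      rw [← map_ofNat (C : ℂ →+* Fock) 2, ← map_mul]; norm_num
    linear_combination (((k : ℕ) : Fock) * a α ((n : ℤ) - k) v) * h3

theorem finite_support_X_mul_a (α : ℂ) (k : ℕ+) (v : Fock) :
    (Function.support fun n : ℕ+ => X n * a α ((n : ℤ) - k) v).Finite := by
  obtain ⟨N, -, hN⟩ := exists_a_eq_zero v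
  exact finite_of_eq_zero (N := N + k) fun n hn => by rw [hN _ _ (by omega), mul_zero]

/-- The operator a_{n-k} creates for n < k, is the scalar α for n = k and annihilates for n > k; the
three ranges give the three terms. -/
theorem finsum_X_mul_a (α : ℂ) (k : ℕ+) (v : Fock) :
    ∑ᶠ n : ℕ+, X n * a α ((n : ℤ) - k) v =
      (∑ x ∈ SymFn.pairs k, X x.1 * X x.2) * v + α • (X k * v) + SymFn.shiftDer k v := by
  have hfin := finite_support_X_mul_a α k v
  have hsplit (n : ℕ+) : X n * a α ((n : ℤ) - k) v =
      (if n < k then X n * a α ((n : ℤ) - k) v else 0) +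
      (if n = k then X n * a α ((n : ℤ) - k) v else 0) +
      (if k < n then X n * a α ((n : ℤ) - k) v else 0) := by
    rcases lt_trichotomy n k with h | h | h
    · rw [if_pos h, if_neg h.ne, if_neg h.not_gt, add_zero, add_zero]
    · subst h; simp
    · rw [if_neg h.not_gt, if_neg h.ne', if_pos h, zero_add, zero_add]
  have hsub (p : ℕ+ → Prop) [DecidablePred p] : (Function.support fun n : ℕ+ =>
      if p n then X n * a α ((n : ℤ) - k) v else 0).Finite :=
    hfin.subset fun n hn hn' => hn (by
      simp only at hn' ⊢; rw [hn', ite_self])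
  rw [finsum_congr hsplit, finsum_add_distrib (((hsub (· < k)).union (hsub (· = k))).subset
    (Function.support_add _ _)) (hsub (k < ·)), finsum_add_distrib (hsub (· < k)) (hsub (· = k))]
  congr 1
  · congr 1
    · rw [finsum_eq_sum_of_support_subset (s := Finset.Iio k) _ fun n hn => by
        by_contra h
        rw [Finset.mem_coe, Finset.mem_Iio] at h
        exact hn (if_neg h), Finset.sum_mul]
      refine Finset.sum_bij' (fun n _ => (n, k - n)) (fun x _ => x.1) ?_ ?_ ?_ ?_ ?_
      · intro n hn
        exact SymFn.mem_pairs.2 (PNat.add_sub_of_lt (Finset.mem_Iio.1 hn))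
      · intro x hx
        rw [Finset.mem_Iio, ← SymFn.mem_pairs.1 hx]
        exact PNat.lt_add_right _ _
      · intro n _
        rfl
      · rintro ⟨i, j⟩ hx
        rw [SymFn.mem_pairs] at hx
        subst hx
        refine Prod.ext rfl (add_left_cancel (a := i) ?_)
        exact PNat.add_sub_of_lt (PNat.lt_add_right _ _)
      · intro n hn
        rw [Finset.mem_Iio] at hn
        have h1 : (n : ℤ) - k = -((k - n : ℕ+) : ℤ) := by
          have := congrArg (fun m : ℕ+ => (m : ℤ)) (PNat.add_sub_of_lt hn)
          simp only [PNat.add_coe, Nat.cast_add] at this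
          omega
        rw [if_pos hn, h1, a_neg, mul_assoc]
    · rw [finsum_eq_single _ k fun n hn => if_neg hn, if_pos rfl, sub_self, a_zero, mul_smul_comm]
  · rw [SymFn.shiftDer, SymFn.mkDerivation_eq_finsum]
    have hinj : Function.Injective fun i : ℕ+ => i + k := fun i j h => add_right_cancel h
    have h1 : ∀ i : ℕ+, (((i : ℕ) : ℂ) • X (i + k)) * pderiv i v =
        X (i + k) * a α (((i + k : ℕ+) : ℤ) - k) v := fun i => by
      rw [PNat.add_coe, Nat.cast_add, add_sub_cancel_right, a_pos, smul_mul_assoc, mul_smul_comm]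
    rw [finsum_congr h1,
      ← finsum_mem_range (f := fun n : ℕ+ => X n * a α ((n : ℤ) - k) v) hinj]
    refine finsum_congr fun n => ?_
    classical
    rw [finsum_eq_if]
    congr 1
    rw [eq_iff_iff]
    refine ⟨fun h => ⟨n - k, ?_⟩, ?_⟩
    · simp only
      rw [add_comm, PNat.add_sub_of_lt h]
    · rintro ⟨i, rfl⟩
      exact PNat.lt_add_left _ _

theorem vir_add (α ρ : ℂ) (n : ℤ) (v w : Fock) :
    vir α ρ n (v + w) = vir α ρ n v + vir α ρ n w := by
  simp only [vir, map_add]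
  rw [finsum_add_distrib (vir_support_finite α n v) (vir_support_finite α n w), smul_add, smul_add]
  abel

theorem splitOp_add (α s : ℂ) (v w : Fock) :
    splitOp α s (v + w) = splitOp α s v + splitOp α s w := by
  have h : (s ^ 2 - 1) • (v + w) - (sqrtTwo * s) • a α 0 (v + w) =
      ((s ^ 2 - 1) • v - (sqrtTwo * s) • a α 0 v) +
      ((s ^ 2 - 1) • w - (sqrtTwo * s) • a α 0 w) := by
    simp only [map_add, smul_add]; abel
  simp only [splitOp, vir_add, h]
  simp only [map_add]
  rw [finsum_add_distrib (splitOp_support_finite α s v).1 (splitOp_support_finite α s w).1,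
    finsum_add_distrib (splitOp_support_finite α s v).2 (splitOp_support_finite α s w).2, smul_add]
  abel

theorem splitOp_C (α s c : ℂ) : splitOp α s (C c) = 0 := by
  have ha : ∀ n : ℤ, 0 < n → a α n (C c) = 0 := fun n hn => by
    rw [show n = (toPNat n hn : ℤ) by simp [toPNat]; omega, a_pos, pderiv_C, smul_zero]
  have hv (n : ℕ+) : vir α (rho s) n (C c) = 0 := by
    have hn : 0 < (n : ℤ) := by exact_mod_cast n.pos
    rw [vir, finsum_eq_zero_of_forall_eq_zero fun m =>
      normalOrdered_eq_zero ha (by omega), ha _ hn]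
    simp
  have h2 (n : ℕ+) : a α n ((s ^ 2 - 1) • (C c : Fock) - (sqrtTwo * s) • a α 0 (C c)) = 0 := by
    have hn : 0 < (n : ℤ) := by exact_mod_cast n.pos
    rw [map_sub, map_smul, map_smul, a_zero, map_smul, ha _ hn]
    simp
  simp [splitOp, hv, h2]

theorem sqrtTwo_sq : sqrtTwo ^ 2 = 2 := by
  rw [sqrtTwo, ← Complex.ofReal_pow, Real.sq_sqrt (by norm_num)]
  norm_num

/-- The zero mode of `finsum_X_mul_a` cancels against the term −√(2β) a_0 of the operator, which
removes α from the commutator. -/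
theorem splitOp_X_mul {s : ℂ} (hs : s ≠ 0) (α : ℂ) (k : ℕ+) (v : Fock) :
    splitOp α s (X k * v) = X k * splitOp α s v +
      (sqrtTwo * s * k) • ((∑ x ∈ SymFn.pairs k, X x.1 * X x.2) * v) +
      ((1 - s ^ 2) * (k : ℂ) ^ 2) • (X k * v) + (sqrtTwo * s * k) • SymFn.shiftDer k v := by
  have hfin1 := (splitOp_support_finite α s v).1
  have hfin2 := (splitOp_support_finite α s v).2
  have hfinX := finite_support_X_mul_a α k v
  simp only [a_neg] at hfin1 hfin2
  set w : Fock := (s ^ 2 - 1) • v - (sqrtTwo * s) • a α 0 v with hw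
  have hw' : (s ^ 2 - 1) • (X k * v) - (sqrtTwo * s) • a α 0 (X k * v) = X k * w := by
    rw [hw, a_zero, a_zero, mul_sub, mul_smul_comm, mul_smul_comm, mul_smul_comm]
  have hmul {f : ℕ+ → Fock} (hf : (Function.support f).Finite) :
      (Function.support fun n => X k * f n).Finite :=
    hf.subset fun m hm hm' => hm (by simp only at hm' ⊢; rw [hm', mul_zero])
  have hsmul {f : ℕ+ → Fock} (c : ℂ) (hf : (Function.support f).Finite) :
      (Function.support fun n => c • f n).Finite :=
    hf.subset fun m hm hm' => hm (by simp only at hm' ⊢; rw [hm', smul_zero])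
  have hsingle (f : ℕ+ → Fock) :
      (Function.support fun n => if n = k then f n else 0).Finite :=
    (Set.finite_singleton k).subset fun n hn => by
      by_contra h
      exact hn (if_neg h)
  have e1 : ∑ᶠ n : ℕ+, a α (-(n : ℤ)) (vir α (rho s) n (X k * v)) =
      X k * ∑ᶠ n : ℕ+, a α (-(n : ℤ)) (vir α (rho s) n v) +
        (k : ℂ) • ∑ᶠ n : ℕ+, X n * a α ((n : ℤ) - k) v +
        X k * (-(((k : ℂ) + 1) * rho s * k) • v) := by
    have (n : ℕ+) : a α (-(n : ℤ)) (vir α (rho s) n (X k * v)) =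
        X k * (X n * vir α (rho s) n v) + (k : ℂ) • (X n * a α ((n : ℤ) - k) v) +
          if n = k then X n * (-(((k : ℂ) + 1) * rho s * k) • v) else 0 := by
      rw [a_neg, vir_X_mul]
      split_ifs with h
      · rw [mul_sub, mul_add, mul_smul_comm, neg_smul, mul_neg]; ring
      · rw [sub_zero, mul_add, mul_smul_comm]; ring
    rw [finsum_congr this, finsum_add_distrib (((hmul hfin1).union (hsmul _ hfinX)).subset
      (Function.support_add _ _)) (hsingle _), finsum_add_distrib (hmul hfin1) (hsmul _ hfinX),
      ← mul_finsum' _ _ hfin1, ← smul_finsum, finsum_eq_single _ k fun n hn => if_neg hn,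
      if_pos rfl]
    simp only [a_neg]
  have e2 : ∑ᶠ n : ℕ+, a α (-(n : ℤ)) (a α n (X k * w)) =
      X k * ∑ᶠ n : ℕ+, a α (-(n : ℤ)) (a α n w) + X k * ((k : ℂ) • w) := by
    have (n : ℕ+) : a α (-(n : ℤ)) (a α n (X k * w)) =
        X k * (X n * a α n w) + if n = k then X n * ((k : ℂ) • w) else 0 := by
      have hiff : ((n : ℤ) = (k : ℤ)) ↔ n = k := by
        rw [Nat.cast_inj, PNat.coe_inj]
      rw [a_neg, a_X_mul]
      simp only [hiff]
      split_ifs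
      · ring
      · ring
    rw [finsum_congr this, finsum_add_distrib (hmul hfin2) (hsingle _), ← mul_finsum' _ _ hfin2,
      finsum_eq_single _ k fun n hn => if_neg hn, if_pos rfl]
    simp only [a_neg]
  rw [splitOp, splitOp, hw', ← hw, e1, e2, finsum_X_mul_a, hw, a_zero]
  -- The background charge contributes −k(k+1)(β−1) and the number operator k(β−1), which together
  -- make (1−β) k².
  have hrho : sqrtTwo * s * rho s = s ^ 2 - 1 := by
    rw [rho]
    field_simp [sqrtTwo_ne_zero]
  have hrho' := congrArg (C : ℂ → Fock) hrho
  simp only [smul_eq_C_mul, map_mul, map_add, map_sub, map_neg, map_one, map_pow,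
    map_natCast] at hrho' ⊢
  linear_combination (-((k : ℕ) : Fock) * (((k : ℕ) : Fock) + 1) * X k * v) * hrho'

/-- The rescaling of the generators that carries `a_{-n}` to `(s / √2) p_n`. -/
noncomputable def rescale (s : ℂ) : Fock →ₐ[ℂ] Fock := aeval fun n => (s / sqrtTwo) • X n

theorem iota_eq (s : ℂ) (v : Fock) : iota s v = SymFn.psumEquiv ℂ (rescale s v) := by
  have h : iota s = (SymFn.psumEquiv ℂ).toAlgHom.comp (rescale s) := by
    refine MvPolynomial.algHom_ext fun n => ?_
    have : (SymFn.psumEquiv ℂ) (MvPolynomial.X n) = SymFn.psum ℂ n := by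
      rw [SymFn.psumEquiv_apply, MvPolynomial.aeval_X]
    simp [iota, rescale, this]
  rw [h]
  rfl

theorem rescale_X (s : ℂ) (n : ℕ+) : rescale s (X n) = (s / sqrtTwo) • X n := by
  rw [rescale, aeval_X]

theorem rescale_shiftDer (s : ℂ) (k : ℕ+) (v : Fock) :
    rescale s (SymFn.shiftDer k v) = SymFn.shiftDer k (rescale s v) := by
  induction v using MvPolynomial.induction_on with
  | C c => simp [SymFn.shiftDer, rescale]
  | add v w hv hw => simp only [map_add, hv, hw]
  | mul_X v n hv =>
    simp only [Derivation.leibniz, smul_eq_mul, map_add, map_mul, hv, rescale_X,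
      Derivation.map_smul]
    simp only [SymFn.shiftDer, mkDerivation_X, map_smul, rescale_X]
    rw [smul_comm]

/-- Both operators kill constants, and with c = s/√2 the commutators match: √2 s = 2c for the
`shiftDer` term and √2 s c = s² for the quadratic one. -/
theorem rescale_splitOp {s : ℂ} (hs : s ≠ 0) (α : ℂ) (v : Fock) :
    rescale s (splitOp α s v) = SymFn.laplaceBeltrami (s ^ 2) (rescale s v) := by
  induction v using MvPolynomial.induction_on with
  | C c =>
    rw [splitOp_C, map_zero, ← mul_one (C c), ← smul_eq_C_mul, map_smul, map_one, map_smul,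
      SymFn.laplaceBeltrami_one, smul_zero]
  | add v w hv hw => rw [splitOp_add, map_add, map_add, map_add, hv, hw]
  | mul_X v k hv =>
    have hc : sqrtTwo * s = 2 * (s / sqrtTwo) := by
      rw [← sqrtTwo_sq]
      field_simp [sqrtTwo_ne_zero]
    have hc2 : sqrtTwo * s * (s / sqrtTwo) = s ^ 2 := by
      field_simp [sqrtTwo_ne_zero]
    have hsum : rescale s (∑ x ∈ SymFn.pairs k, X x.1 * X x.2) =
        C (s / sqrtTwo) ^ 2 * ∑ x ∈ SymFn.pairs k, X x.1 * X x.2 := by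
      rw [map_sum, Finset.mul_sum]
      refine Finset.sum_congr rfl fun x _ => ?_
      rw [map_mul, rescale_X, rescale_X, smul_eq_C_mul, smul_eq_C_mul]
      ring
    rw [mul_comm, splitOp_X_mul hs]
    simp only [map_add, map_smul, map_mul, hv, rescale_shiftDer, hsum, rescale_X, smul_mul_assoc,
      SymFn.laplaceBeltrami_X_mul]
    have hc' := congrArg (C : ℂ → Fock) hc
    have hc2' := congrArg (C : ℂ → Fock) hc2
    simp only [smul_eq_C_mul, map_mul, map_sub, map_one, map_pow, map_natCast, map_ofNat] at hc' hc2' ⊢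
    linear_combination (((k : ℕ) : Fock) * SymFn.shiftDer k (rescale s v)) * hc' +
      (C (s / sqrtTwo) * ((k : ℕ) : Fock) * (∑ x ∈ SymFn.pairs k, X x.1 * X x.2) *
        rescale s v) * hc2'

/-- Under `ι_β` the operator `Ê_β` becomes the Laplace–Beltrami operator. -/
theorem iota_splitOp {s : ℂ} (hs : s ≠ 0) (α : ℂ) (v : Fock) :
    iota s (splitOp α s v) = SymFn.lamOp (s ^ 2) (iota s v) := by
  rw [iota_eq, iota_eq, SymFn.lamOp_psumEquiv, rescale_splitOp hs]

end Heis

theorem proposition2p2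
    (P : YoungDiagram → SymFn.Lam (RatFunc ℚ)) (hP : SymFn.IsJackFamily P)
    (β s : ℂ) (hs : s ≠ 0) (hsβ : s ^ 2 = β) (α : ℂ)
    (lam : YoungDiagram) (hreg : SymFn.RegularAt (P lam) β⁻¹) :
    Heis.splitOp α s (Heis.iotaInv hs (SymFn.specialize (P lam) β⁻¹))
      = Heis.eps β lam • Heis.iotaInv hs (SymFn.specialize (P lam) β⁻¹) := by
  refine (Heis.iota_bijective hs).1 ?_
  rw [Heis.iota_splitOp hs, map_smul, Heis.iota_iotaInv, hsβ]
  -- `SymFn.eigenvalue` over ℂ and `Heis.eps` unfold to the same sum.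
  exact SymFn.lamOp_specialize (hsβ ▸ pow_ne_zero 2 hs) hreg (hP.lamOp_eq lam)
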